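/- **Theorem (mixing time for multi-dimensional Gaussians with the same initialization mean).** Let $d\ge 1$, $\beta>0$, $\Sigma=\mathrm{diag}(\xi^{(1)},\dots,\xi^{(d)})$ with all $\xi^{(i)}>0$, and $V(x)=\tfrac12x^\top\Sigma^{-1}x$ on $\mathbb R^d$. For $T>0$ and a probability measure $\mu$ on $\mathbb R^d$ let $$\rho_T^{\mu}(x)=\int K(x,y)\,d\mu(y),\qquad K(x,y)=\frac{\exp\!\big(-\frac1{2\beta}(V(x)+\frac{\|x-y\|^2}{2T})\big)}{\int_{\mathbb R^d}\exp\!\big(-\frac1{2\beta}(V(z)+\frac{\|z-y\|^2}{2T})\big)\,dz}$$ be the density of its regularized Wasserstein proximal. For $\eta>0$, the backwards regularized Wasserstein proximal (BRWP) scheme is $$X_{k+1}=X_k-\eta\nabla V(X_k)-\eta\beta\,\nabla\log\rho_T^{\mu(X_k)}(X_k),$$ where $\mu(X_k)$ is the law of $X_k$; let $\mathcal T$ be the induced map $\mu(X_k)\mapsto\mu(X_{k+1})$ on probability measures. Assume $T<\min_i\xi^{(i)}$ and, for all $i$, $$\eta\,\xi^{(i)-1}\le \frac1{\Delta(\xi^{(i)},T)},\qquad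 \Delta(\xi,T)=\frac12\Big(\sqrt{\tfrac{\xi+T}{2T}}+1\Big).$$ 1. *(Stationary distribution.)* Let $\tau_\infty^{(i)}=\beta\xi^{(i)}(1-T^2\xi^{(i)-2})>0$ and $\Sigma_\infty=\mathrm{diag}(\tau_\infty^{(i)})$. Then $\Pi=\mathcal N(0,\Sigma_\infty)$ satisfies $\mathcal T(\Pi)=\Pi$, and it is the only fixed point of $\mathcal T$ among the distributions $\mathcal N(0,\mathrm{diag}(v))$ with all $v_i>0$. Let $X_0\sim\mathcal N(0,\mathrm{diag}(\tau_0^{(i)}))$ with all $\tau_0^{(i)}>0$, and let $(X_k)_{k\ge0}$ evolve under the scheme. 2. *(Law of the iterates.)* For all $k$, $X_k\sim\mathcal N(0,\Sigma_k)$ with $\Sigma_k=\mathrm{diag}(\tau_k^{(i)})$, $\tau_k^{(i)}>0$ and $$\tau_{k+1}^{(i)}=\Big(1-\eta\xi^{(i)-1}+\frac{\eta\beta(1+T\xi^{(i)-1})^2}{\tau_k^{(i)}+2\beta T(1+T\xi^{(i)-1})}\Big)^2\tau_k^{(i)}.$$ 3. *(Linear convergence.)* The eigenvalues of $\Sigma_k\Sigma_\infty^{-1}-I$,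 with multiplicity, are $\lambda_k^{(i)}=(\tau_k^{(i)}-\tau_\infty^{(i)})/\tau_\infty^{(i)}$, $i=1,\dots,d$. For every $i$, $\lambda_k^{(i)}\to0$ as $k\to\infty$, and either $\lambda_k^{(i)}=0$ for all large $k$ or $$\frac{\lambda_{k+1}^{(i)}}{\lambda_k^{(i)}}\to r^{(i)}=1-2\eta\,\xi^{(i)-1}\,\frac{\xi^{(i)}-T}{\xi^{(i)}+T}.$$ Here $r^{(i)}\in[0,1)$, and $r^{(i)}=0$ if and only if $\xi^{(i)}=7T$ and $\eta\xi^{(i)-1}=1/\Delta(\xi^{(i)},T)$. 4. *(Total variation.)* Let $C=\big(\frac1d\sum_i(\lambda_0^{(i)})^2\big)^{1/2}$ and let $c=\sup_{i,k}|\lambda_{k+1}^{(i)}|/|\lambda_k^{(i)}|$ (with $0/0=0$) be the largest rate of contraction. Then $c\in[0,1)$, with $c=0$ if and only if $\lambda_1^{(i)}=0$ for all $i$; $|\lambda_{k+1}^{(i)}|\le c\,|\lambda_k^{(i)}|$ for all $i$ and $k$; and for all $k\ge0$ (with $0^0=1$) $$\mathrm{TV}(\mu(X_k),\Pi)\le\frac32\min\Big\{1,\sqrt{\textstyle\sum_{i=1}^d(\lambda_k^{(i)})^2}\Big\}\le\frac32\,C\sqrt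 d\,c^k,$$ where $\mathrm{TV}(P,Q)=\sup_A|P(A)-Q(A)|$ over Borel sets $A$. 5. *(Mixing time.)* Let $\delta\in(0,1)$ and $t_{\rm mix}(\delta)=\min\{k\mid\mathrm{TV}(\mathcal T^k(\mu(X_0)),\Pi)\le\delta\}$. If $c=0$, then $t_{\rm mix}(\delta)\le1$. If $c>0$, then $$t_{\rm mix}(\delta)\le\max\Big\{0,\Big\lceil\frac{\log\big(\tfrac32C\sqrt d/\delta\big)}{\log(1/c)}\Big\rceil\Big\},$$ and if moreover $\delta\le\frac23cC\sqrt d$, then $$t_{\rm mix}(\delta)\le 2\,\frac{\log(C\sqrt d/\delta)}{\log(1/c)};$$ in particular $t_{\rm mix}(\delta)=\mathcal O\big(\log(C\sqrt d/\delta)/\log(1/c)\big)$ as $\delta\to0$, with an absolute constant. -/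

import Mathlib

open MeasureTheory ProbabilityTheory Filter Topology
open scoped Matrix ENNReal

noncomputable section

namespace BRWP

/-- Euclidean space `ℝ^d` with its Euclidean norm. -/
abbrev E (d : ℕ) : Type := EuclideanSpace ℝ (Fin d)

/-- The quadratic potential `V(x) = ½ xᵀ S⁻¹ x`. -/
def quadraticPotential {d : ℕ} (S : Matrix (Fin d) (Fin d) ℝ) (x : E d) : ℝ :=
  (1 / 2) * (x.ofLp ⬝ᵥ (S⁻¹ *ᵥ x.ofLp))

/-- The unnormalised kernel `exp (-(V(x) + ‖x - y‖² / (2T)) / (2β))`. -/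
def kernelNum {d : ℕ} (V : E d → ℝ) (β T : ℝ) (x y : E d) : ℝ :=
  Real.exp (-(1 / (2 * β)) * (V x + ‖x - y‖ ^ 2 / (2 * T)))

/-- The kernel `K(x, y)` of the regularized Wasserstein proximal:
the kernel `kernelNum` normalised to have integral one in its first variable. -/
def kernel {d : ℕ} (V : E d → ℝ) (β T : ℝ) (x y : E d) : ℝ :=
  kernelNum V β T x y / ∫ z, kernelNum V β T z y

/-- The density `ρ_T(x) = ∫ K(x, y) dμ(y)` of the regularized Wasserstein proximal of `μ`. -/
def wproxDensity {d : ℕ} (V : E d → ℝ) (β T : ℝ) (μ : Measure (E d)) (x : E d) : ℝ :=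
  ∫ y, kernel V β T x y ∂μ

/-- One particle update `x ↦ x - η ∇V(x) - η β ∇ log ρ_T(x)`, where `ρ_T` is the regularized
Wasserstein proximal of the current distribution `μ` of the particle. -/
def stepMap {d : ℕ} (V : E d → ℝ) (β T η : ℝ) (μ : Measure (E d)) (x : E d) : E d :=
  x - η • gradient V x - (η * β) • gradient (fun z => Real.log (wproxDensity V β T μ z)) x

/-- The operator on distributions induced by one update: the law of the updated particle. -/
def stepLaw {d : ℕ} (V : E d → ℝ) (β T η : ℝ) (μ : Measure (E d)) : Measure (E d) :=
  μ.map (stepMap V β T η μ)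

/-- `X` evolves under the BRWP scheme: `X_{k+1} = X_k - η ∇V(X_k) - η β ∇ log ρ_{k,T}(X_k)`,
where `ρ_{k,T}` is the regularized Wasserstein proximal of the law of `X_k`. -/
def IsScheme {d : ℕ} {Ω : Type*} [MeasurableSpace Ω] (V : E d → ℝ) (β T η : ℝ)
    (P : Measure Ω) (X : ℕ → Ω → E d) : Prop :=
  ∀ k, ∀ᵐ ω ∂P, X (k + 1) ω = stepMap V β T η (P.map (X k)) (X k ω)

/-- Centred Gaussian distribution with covariance matrix `diag(v)`. -/
def diagGaussian {d : ℕ} (v : Fin d → ℝ) : Measure (E d) :=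
  multivariateGaussian 0 (Matrix.diagonal v)

/-- Total variation distance `sup_A |P(A) - Q(A)|` over the measurable sets `A`. -/
def tv {α : Type*} [MeasurableSpace α] (P Q : Measure α) : ℝ :=
  ⨆ A : {A : Set α // MeasurableSet A}, |P.real A.1 - Q.real A.1|

/-- The `δ`-mixing time `min {k | TV(𝒯^k(μ₀), Π) ≤ δ}`; it is `⊤` if there is no such `k`. -/
def mixingTime {α : Type*} [MeasurableSpace α] (op : Measure α → Measure α)
    (μ₀ target : Measure α) (δ : ℝ) : ℕ∞ :=
  sInf ((fun k : ℕ => (k : ℕ∞)) '' {k : ℕ | tv (op^[k] μ₀) target ≤ δ})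

/-- `Δ(ξ, T) = ½ (√((ξ + T) / (2T)) + 1)`. -/
def stepBound (ξ T : ℝ) : ℝ := (1 / 2) * (√((ξ + T) / (2 * T)) + 1)

/-- The stationary variance `β ξ (1 - T² ξ⁻²)`. -/
def varLimit (β T ξ : ℝ) : ℝ := β * ξ * (1 - T ^ 2 * (ξ ^ 2)⁻¹)

/-- The sequence of variances in a coordinate with target variance parameter `ξ`, started
from `τ₀`. -/
def variance (β T η ξ τ₀ : ℝ) : ℕ → ℝ
  | 0 => τ₀
  | k + 1 =>
      (1 - η * ξ⁻¹ + η * β * (1 + T * ξ⁻¹) ^ 2 /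
        (variance β T η ξ τ₀ k + 2 * β * T * (1 + T * ξ⁻¹))) ^ 2 * variance β T η ξ τ₀ k

/-- The relative error `(τ_k - τ_∞) / τ_∞`. -/
def relErr (β T η ξ τ₀ : ℝ) (k : ℕ) : ℝ :=
  (variance β T η ξ τ₀ k - varLimit β T ξ) / varLimit β T ξ

/-- The asymptotic rate `1 - 2 η ξ⁻¹ (ξ - T) / (ξ + T)`. -/
def asympRate (T η ξ : ℝ) : ℝ := 1 - 2 * η * ξ⁻¹ * (ξ - T) / (ξ + T)

/-- The constant `C`: root mean square of the initial relative errors. -/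
def rmsInit {d : ℕ} (β T η : ℝ) (ξ τ₀ : Fin d → ℝ) : ℝ :=
  √((∑ i, relErr β T η (ξ i) (τ₀ i) 0 ^ 2) / d)

/-- The constant `c`: the largest contraction factor `|λ_{k+1}| / |λ_k|` of the relative errors,
over all coordinates and all iterations (a vanishing `λ_k` contributes `0`). -/
def worstRate {d : ℕ} (β T η : ℝ) (ξ τ₀ : Fin d → ℝ) : ℝ :=
  ⨆ p : Fin d × ℕ, |relErr β T η (ξ p.1) (τ₀ p.1) (p.2 + 1)| / |relErr β T η (ξ p.1) (τ₀ p.1) p.2|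

end BRWP

end

namespace BRWP

/-! ### The scalar recursion of the relative errors -/

/-! On a centred diagonal Gaussian everything decouples. In each coordinate the proximal kernel is
Gaussian in its first variable, with mean linear in the second, so the proximal of `N(0, v)` is
again a centred Gaussian, its score is linear, and one update multiplies the coordinate by a
constant `stepFactor` (`stepMap_diagGaussian`). The law therefore evolves through a scalar recursion
for the variances.

Put `a = η / ξ`, `κ = (ξ - T) / (ξ + T)` and let `l > -1` be the relative error of the variance. The
recursion becomes `1 + l' = g² (1 + l)` with `g = 1 - a κ l / (1 + κ l)`, and it factors as `l' =
q(l) l` with `q = contraction`. Two bounds carry the convergence. The step-size condition makes a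
quadratic discriminant nonpositive, which gives `q ≥ 0` (`contraction_nonneg`): errors never change
sign. Positivity of `g` gives `q ≤ 1 - a κ min(1, 1 + l)` (`contraction_le`). Together they prevent
a negative error from moving back towards `-1`, so the second bound is uniform in time. The
asymptotic rate is `q(0)`.

For total variation, the Hellinger affinity of two diagonal Gaussians is an explicit product over
coordinates. Cauchy-Schwarz turns it into a bound by the Euclidean norm of the relative errors, with
constant `1`, stronger than the required `3/2`. Geometric decay of that norm then gives the mixing
time by taking logarithms. -/

/-- The factor by which one step scales a coordinate with relative variance error `l`. -/
noncomputable def scaleFactor (a κ l : ℝ) : ℝ := 1 - a * κ * l / (1 + κ * l)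

/-- The factor by which one step multiplies the relative variance error `l`. -/
noncomputable def contraction (a κ l : ℝ) : ℝ :=
  1 - 2 * a * κ * (1 + l) / (1 + κ * l) + a ^ 2 * κ ^ 2 * l * (1 + l) / (1 + κ * l) ^ 2

section Scalar

variable {a κ l w : ℝ}

lemma one_add_mul_pos (hκ : 0 < κ) (hκ1 : κ < 1) (hl : -1 < l) : 0 < 1 + κ * l := by
  nlinarith

lemma scaleFactor_pos (ha1 : a < 1) (ha : 0 < a) (hκ : 0 < κ) (hκ1 : κ < 1)
    (hl : -1 < l) : 0 < scaleFactor a κ l := by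
  have h := one_add_mul_pos hκ hκ1 hl
  have h2 : 0 < 1 + κ * (1 - a) * l := by
    have : κ * (1 - a) < 1 := by nlinarith
    exact one_add_mul_pos (mul_pos hκ (by linarith)) this hl
  have : scaleFactor a κ l = (1 + κ * (1 - a) * l) / (1 + κ * l) := by
    unfold scaleFactor; field_simp; ring
  rw [this]; positivity

lemma sq_scaleFactor_mul (h : 1 + κ * l ≠ 0) :
    scaleFactor a κ l ^ 2 * (1 + l) = 1 + contraction a κ l * l := by
  unfold scaleFactor contraction; field_simp; ring

lemma one_sub_contraction (h : 1 + κ * l ≠ 0) : 1 - contraction a κ l =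
    a * κ * ((1 + l) / (1 + κ * l)) * (1 + scaleFactor a κ l) := by
  unfold scaleFactor contraction; field_simp; ring

/-- In `one_sub_contraction` the last factor `1 + g` exceeds `1` because `g > 0`, and `(1 + l) / (1
+ κ l)` is at least `1` for `l ≥ 0` and at least `1 + l` for `l ≤ 0`. -/
lemma contraction_le (ha1 : a < 1) (ha : 0 < a) (hκ : 0 < κ) (hκ1 : κ < 1)
    (hl : -1 < l) : contraction a κ l ≤ 1 - a * κ * min 1 (1 + l) := by
  have h := one_add_mul_pos hκ hκ1 hl
  have h1 : min 1 (1 + l) ≤ (1 + l) / (1 + κ * l) := by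
    rw [le_div_iff₀ h]
    rcases le_total 0 l with h0 | h0
    · rw [min_eq_left (by linarith)]; nlinarith
    · rw [min_eq_right (by linarith)]; nlinarith [mul_nonneg hκ.le (neg_nonneg.2 h0)]
  have h2 := scaleFactor_pos ha1 ha hκ hκ1 hl
  have h3 := one_sub_contraction (a := a) h.ne'
  have h4 : 0 < (1 + l) / (1 + κ * l) := div_pos (by linarith) h
  have h5 : a * κ * min 1 (1 + l) ≤ a * κ * ((1 + l) / (1 + κ * l)) := by gcongr
  have h6 : 0 ≤ a * κ * ((1 + l) / (1 + κ * l)) * scaleFactor a κ l := by positivity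
  linarith

/-- With `1 + l = y²`, both `l = (y - 1)(y + 1)` and `l' = (g y - 1)(g y + 1)` factor. The common
factor `y - 1` cancels from the quotient `l' / l`, leaving a quadratic in `y` whose discriminant is
nonpositive exactly under the step-size condition. -/
lemma contraction_nonneg (hw : 0 < w) (hw1 : w < 1) (ha : 0 < a) (haw : a * (1 + w) ≤ 2 * w)
    (hκw : κ = 1 - w ^ 2) (hl : -1 < l) : 0 ≤ contraction a κ l := by
  have hκ : 0 < κ := by rw [hκw]; nlinarith
  have hκ1 : κ < 1 := by rw [hκw]; nlinarith
  have ha1 : a < 1 := by nlinarith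
  have h := one_add_mul_pos hκ hκ1 hl
  have hg := scaleFactor_pos ha1 ha hκ hκ1 hl
  obtain ⟨y, hy, rfl⟩ : ∃ y : ℝ, 0 < y ∧ l = y ^ 2 - 1 :=
    ⟨√(1 + l), Real.sqrt_pos.2 (by linarith), by rw [Real.sq_sqrt (by linarith)]; ring⟩
  have hq : 0 ≤ κ * (1 - a) * y ^ 2 - κ * a * y + w ^ 2 := by
    have h1 : 0 ≤ (2 * w - a * (1 + w)) * (2 * w + a * (1 - w)) :=
      mul_nonneg (by linarith) (by nlinarith)
    have h2 : 0 ≤ 4 * (κ * (1 - a)) * (κ * (1 - a) * y ^ 2 - κ * a * y + w ^ 2) := by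
      have : 4 * (κ * (1 - a)) * (κ * (1 - a) * y ^ 2 - κ * a * y + w ^ 2) =
        (2 * κ * (1 - a) * y - κ * a) ^ 2 +
          κ * ((2 * w - a * (1 + w)) * (2 * w + a * (1 - w))) := by
        rw [hκw]; ring
      rw [this]; positivity
    exact nonneg_of_mul_nonneg_right h2 (by have := sub_pos.2 ha1; positivity)
  have key : contraction a κ (y ^ 2 - 1) =
      (κ * (1 - a) * y ^ 2 - κ * a * y + w ^ 2) * (scaleFactor a κ (y ^ 2 - 1) * y + 1) /
        ((1 + κ * (y ^ 2 - 1)) * (y + 1)) := by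
    have hw2 : w ^ 2 = 1 - κ := by rw [hκw]; ring
    have hy1 : y + 1 ≠ 0 := by positivity
    have h' := h.ne'
    rw [hw2]
    unfold scaleFactor contraction
    field_simp
    ring
  rw [key]
  positivity

lemma continuousAt_contraction_zero : ContinuousAt (contraction a κ) 0 := by
  unfold contraction
  refine ContinuousAt.add (ContinuousAt.sub (by fun_prop) (ContinuousAt.div (by fun_prop)
    (by fun_prop) (by simp))) (ContinuousAt.div (by fun_prop) (by fun_prop) (by simp))

end Scalar

/-- The rate parameter `κ = (ξ - T) / (ξ + T)`. -/
noncomputable def kap (T ξ : ℝ) : ℝ := (ξ - T) / (ξ + T)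

/-! ### From the parameters of the scheme to the scalar recursion. -/

section Params

variable {β T η ξ τ₀ : ℝ}

lemma kap_pos (hT : 0 < T) (hTξ : T < ξ) : 0 < kap T ξ :=
  div_pos (by linarith) (by linarith)

lemma kap_lt_one (hT : 0 < T) (hTξ : T < ξ) : kap T ξ < 1 := by
  unfold kap; rw [div_lt_one (by linarith)]; linarith

lemma varLimit_pos (hβ : 0 < β) (hT : 0 < T) (hTξ : T < ξ) : 0 < varLimit β T ξ := by
  have hξ : 0 < ξ := hT.trans hTξ
  have : varLimit β T ξ = β * (ξ - T) * (ξ + T) / ξ := by unfold varLimit; field_simp; ring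
  rw [this]
  have := sub_pos.2 hTξ
  positivity

/-- Since `1 - κ = 2T / (ξ + T)`, the square root in `stepBound` is `1 / w` with `w = √(1 - κ)`.
This puts the step-size condition in the form `a (1 + w) ≤ 2 w` used by `contraction_nonneg`. -/
lemma one_div_stepBound (hT : 0 < T) (hTξ : T < ξ) :
    1 / stepBound ξ T = 2 * √(1 - kap T ξ) / (1 + √(1 - kap T ξ)) := by
  have h1 : (ξ + T) / (2 * T) = (1 - kap T ξ)⁻¹ := by
    have : ξ + T ≠ 0 := by linarith
    have h : 1 - kap T ξ = 2 * T / (ξ + T) := by unfold kap; field_simp; ring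
    rw [h, inv_div]
  have h2 : 0 < √(1 - kap T ξ) := Real.sqrt_pos.2 (by linarith [kap_lt_one hT hTξ])
  unfold stepBound
  rw [h1, Real.sqrt_inv]
  field_simp

lemma rate_mul_le (hT : 0 < T) (hTξ : T < ξ) (hstep : η * ξ⁻¹ ≤ 1 / stepBound ξ T) :
    η * ξ⁻¹ * (1 + √(1 - kap T ξ)) ≤ 2 * √(1 - kap T ξ) := by
  rw [one_div_stepBound hT hTξ, le_div_iff₀ (by positivity)] at hstep
  exact hstep

lemma sqrt_one_sub_kap_pos (hT : 0 < T) (hTξ : T < ξ) : 0 < √(1 - kap T ξ) :=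
  Real.sqrt_pos.2 (by linarith [kap_lt_one hT hTξ])

lemma sqrt_one_sub_kap_lt_one (hT : 0 < T) (hTξ : T < ξ) : √(1 - kap T ξ) < 1 := by
  rw [Real.sqrt_lt' one_pos]; linarith [kap_pos hT hTξ]

lemma kap_eq_one_sub_sq (hT : 0 < T) (hTξ : T < ξ) : kap T ξ = 1 - √(1 - kap T ξ) ^ 2 := by
  rw [Real.sq_sqrt (by linarith [kap_lt_one hT hTξ])]; ring

lemma rate_lt_one (hT : 0 < T) (hTξ : T < ξ)
    (hstep : η * ξ⁻¹ ≤ 1 / stepBound ξ T) : η * ξ⁻¹ < 1 := by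
  have := rate_mul_le hT hTξ hstep
  have := sqrt_one_sub_kap_pos hT hTξ
  have := sqrt_one_sub_kap_lt_one hT hTξ
  nlinarith

lemma asympRate_eq (T η ξ : ℝ) : asympRate T η ξ = 1 - 2 * (η * ξ⁻¹) * kap T ξ := by
  unfold asympRate kap; ring

lemma asympRate_eq_contraction (T η ξ : ℝ) :
    asympRate T η ξ = contraction (η * ξ⁻¹) (kap T ξ) 0 := by
  rw [asympRate_eq]; simp [contraction]

lemma asympRate_nonneg (hT : 0 < T) (hTξ : T < ξ) (hη : 0 < η)
    (hstep : η * ξ⁻¹ ≤ 1 / stepBound ξ T) : 0 ≤ asympRate T η ξ := by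
  have hξ : 0 < ξ := hT.trans hTξ
  rw [asympRate_eq_contraction]
  exact contraction_nonneg (sqrt_one_sub_kap_pos hT hTξ) (sqrt_one_sub_kap_lt_one hT hTξ)
    (by positivity) (rate_mul_le hT hTξ hstep) (kap_eq_one_sub_sq hT hTξ) (by norm_num)

lemma asympRate_lt_one (hT : 0 < T) (hTξ : T < ξ) (hη : 0 < η) : asympRate T η ξ < 1 := by
  have hξ : 0 < ξ := hT.trans hTξ
  have := kap_pos hT hTξ
  rw [asympRate_eq]
  have : 0 < 2 * (η * ξ⁻¹) * kap T ξ := by positivity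
  linarith

lemma asympRate_eq_zero_iff (hT : 0 < T) (hTξ : T < ξ)
    (hstep : η * ξ⁻¹ ≤ 1 / stepBound ξ T) :
    asympRate T η ξ = 0 ↔ ξ = 7 * T ∧ η * ξ⁻¹ = 1 / stepBound ξ T := by
  have hle := rate_mul_le hT hTξ hstep
  have hw := sqrt_one_sub_kap_pos hT hTξ
  have hw1 := sqrt_one_sub_kap_lt_one hT hTξ
  have hκ := kap_eq_one_sub_sq hT hTξ
  rw [asympRate_eq, one_div_stepBound hT hTξ, eq_div_iff (by positivity)]
  set w := √(1 - kap T ξ) with hwdef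
  set a := η * ξ⁻¹
  have hseven : ξ = 7 * T ↔ kap T ξ = 3 / 4 := by
    unfold kap
    rw [div_eq_iff (by linarith)]
    constructor <;> intro h <;> linarith
  rw [hseven]
  constructor
  · intro h
    have h1 : a * (1 + w) * (1 - w) = 1 / 2 := by
      rw [hκ] at h; nlinarith
    -- The right side is at most `1/2`, with equality only at `w = 1/2`. A zero rate thus forces
    -- equality both here and in the step-size condition.
    have h2 : a * (1 + w) * (1 - w) ≤ 2 * w * (1 - w) := by gcongr
    have h3 : w = 1 / 2 := by nlinarith [sq_nonneg (w - 1 / 2)]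
    refine ⟨by rw [hκ, h3]; norm_num, ?_⟩
    rw [h3] at h1 ⊢; linarith
  · rintro ⟨h1, h2⟩
    have h3 : w = 1 / 2 := by
      have : (w - 1 / 2) * (w + 1 / 2) = 0 := by linarith
      rcases mul_eq_zero.1 this with h | h <;> linarith
    rw [h1]; rw [h3] at h2; linarith

lemma neg_one_lt_sub_div {v s : ℝ} (hv : 0 < v) (hs : 0 < s) : -1 < (v - s) / s := by
  rw [sub_div, div_self hs.ne']; linarith [div_pos hv hs]

/-- The scaling of a coordinate of variance `v` under one step. -/
noncomputable def stepFactor (β T η ξ v : ℝ) : ℝ :=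
  1 - η * ξ⁻¹ + η * β * (1 + T * ξ⁻¹) ^ 2 / (v + 2 * β * T * (1 + T * ξ⁻¹))

/-- Writing `v = τ_∞ (1 + l)`, the denominator of `stepFactor` becomes `β ξ (1 + T / ξ)² (1 + κ l)`;
the prefactor cancels and only `a`, `κ`, `l` remain. -/
lemma stepFactor_eq (hβ : 0 < β) (hT : 0 < T) (hTξ : T < ξ) {v : ℝ} (hv : 0 < v) :
    stepFactor β T η ξ v =
      scaleFactor (η * ξ⁻¹) (kap T ξ) ((v - varLimit β T ξ) / varLimit β T ξ) := by
  have hξ : 0 < ξ := hT.trans hTξ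
  have hs := varLimit_pos hβ hT hTξ
  obtain ⟨l, hl, rfl⟩ : ∃ l, -1 < l ∧ v = varLimit β T ξ * (1 + l) :=
    ⟨(v - varLimit β T ξ) / varLimit β T ξ, neg_one_lt_sub_div hv hs, by field_simp; ring⟩
  have h1 : (varLimit β T ξ * (1 + l) - varLimit β T ξ) / varLimit β T ξ = l := by
    field_simp; ring
  have hd := one_add_mul_pos (kap_pos hT hTξ) (kap_lt_one hT hTξ) hl
  have h2 : varLimit β T ξ * (1 + l) + 2 * β * T * (1 + T * ξ⁻¹) =
      β * ξ * (1 + T * ξ⁻¹) ^ 2 * (1 + kap T ξ * l) := by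
    have : ξ + T ≠ 0 := by linarith
    unfold varLimit kap; field_simp; ring
  have h3 : 0 < 1 + T * ξ⁻¹ := by positivity
  rw [h1]
  unfold stepFactor scaleFactor
  rw [h2]
  field_simp
  ring

lemma stepFactor_pos (hβ : 0 < β) (hT : 0 < T) (hTξ : T < ξ) (hη : 0 < η)
    (hstep : η * ξ⁻¹ ≤ 1 / stepBound ξ T) {v : ℝ} (hv : 0 < v) : 0 < stepFactor β T η ξ v := by
  have hξ : 0 < ξ := hT.trans hTξ
  rw [stepFactor_eq hβ hT hTξ hv]
  exact scaleFactor_pos (rate_lt_one hT hTξ hstep) (by positivity) (kap_pos hT hTξ)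
    (kap_lt_one hT hTξ) (neg_one_lt_sub_div hv (varLimit_pos hβ hT hTξ))

lemma stepFactor_eq_one_iff (hβ : 0 < β) (hT : 0 < T) (hTξ : T < ξ) (hη : 0 < η)
    {v : ℝ} (hv : 0 < v) : stepFactor β T η ξ v = 1 ↔ v = varLimit β T ξ := by
  have hξ : 0 < ξ := hT.trans hTξ
  have hs := varLimit_pos hβ hT hTξ
  have hκ := kap_pos hT hTξ
  have hd := one_add_mul_pos hκ (kap_lt_one hT hTξ) (neg_one_lt_sub_div hv hs)
  rw [stepFactor_eq hβ hT hTξ hv]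
  constructor
  · intro h
    have h1 : η * ξ⁻¹ * kap T ξ * ((v - varLimit β T ξ) / varLimit β T ξ) = 0 := by
      unfold scaleFactor at h
      have := (div_eq_zero_iff.1 (sub_eq_self.1 h)).resolve_right hd.ne'
      exact this
    have h2 : η * ξ⁻¹ * kap T ξ ≠ 0 := by positivity
    have h3 := (div_eq_zero_iff.1 ((mul_eq_zero.1 h1).resolve_left h2)).resolve_right hs.ne'
    linarith
  · intro h
    simp [scaleFactor, h]

lemma variance_succ (β T η ξ τ₀ : ℝ) (k : ℕ) : variance β T η ξ τ₀ (k + 1) =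
    stepFactor β T η ξ (variance β T η ξ τ₀ k) ^ 2 * variance β T η ξ τ₀ k := rfl

lemma variance_pos (hβ : 0 < β) (hT : 0 < T) (hTξ : T < ξ) (hη : 0 < η)
    (hstep : η * ξ⁻¹ ≤ 1 / stepBound ξ T) (hτ : 0 < τ₀) (k : ℕ) :
    0 < variance β T η ξ τ₀ k := by
  induction k with
  | zero => exact hτ
  | succ k ih =>
    rw [variance_succ]
    have := stepFactor_pos hβ hT hTξ hη hstep ih
    positivity

lemma neg_one_lt_relErr (hβ : 0 < β) (hT : 0 < T) (hTξ : T < ξ) (hη : 0 < η)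
    (hstep : η * ξ⁻¹ ≤ 1 / stepBound ξ T) (hτ : 0 < τ₀) (k : ℕ) :
    -1 < relErr β T η ξ τ₀ k :=
  neg_one_lt_sub_div (variance_pos hβ hT hTξ hη hstep hτ k) (varLimit_pos hβ hT hTξ)

lemma relErr_succ (hβ : 0 < β) (hT : 0 < T) (hTξ : T < ξ) (hη : 0 < η)
    (hstep : η * ξ⁻¹ ≤ 1 / stepBound ξ T) (hτ : 0 < τ₀) (k : ℕ) :
    relErr β T η ξ τ₀ (k + 1) =
      contraction (η * ξ⁻¹) (kap T ξ) (relErr β T η ξ τ₀ k) * relErr β T η ξ τ₀ k := by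
  have hs := varLimit_pos hβ hT hTξ
  have hv := variance_pos hβ hT hTξ hη hstep hτ k
  have hd := one_add_mul_pos (kap_pos hT hTξ) (kap_lt_one hT hTξ)
    (neg_one_lt_relErr hβ hT hTξ hη hstep hτ k)
  have h1 := sq_scaleFactor_mul (a := η * ξ⁻¹) hd.ne'
  have h2 : relErr β T η ξ τ₀ (k + 1) = scaleFactor (η * ξ⁻¹) (kap T ξ) (relErr β T η ξ τ₀ k) ^ 2 *
      (1 + relErr β T η ξ τ₀ k) - 1 := by
    conv_lhs => unfold relErr
    rw [variance_succ, stepFactor_eq hβ hT hTξ hv]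
    unfold relErr
    field_simp
    ring
  rw [h2, h1]; ring

lemma contraction_relErr_nonneg (hβ : 0 < β) (hT : 0 < T) (hTξ : T < ξ) (hη : 0 < η)
    (hstep : η * ξ⁻¹ ≤ 1 / stepBound ξ T) (hτ : 0 < τ₀) (k : ℕ) :
    0 ≤ contraction (η * ξ⁻¹) (kap T ξ) (relErr β T η ξ τ₀ k) := by
  have hξ : 0 < ξ := hT.trans hTξ
  exact contraction_nonneg (sqrt_one_sub_kap_pos hT hTξ) (sqrt_one_sub_kap_lt_one hT hTξ)
    (by positivity) (rate_mul_le hT hTξ hstep) (kap_eq_one_sub_sq hT hTξ)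
    (neg_one_lt_relErr hβ hT hTξ hη hstep hτ k)

/-- An upper bound `< 1` for all contraction factors of one coordinate. -/
noncomputable def rateBound (β T η ξ τ₀ : ℝ) : ℝ :=
  1 - η * ξ⁻¹ * kap T ξ * min 1 (1 + relErr β T η ξ τ₀ 0)

lemma rateBound_lt_one (hβ : 0 < β) (hT : 0 < T) (hTξ : T < ξ) (hη : 0 < η)
    (hstep : η * ξ⁻¹ ≤ 1 / stepBound ξ T) (hτ : 0 < τ₀) : rateBound β T η ξ τ₀ < 1 := by
  have hξ : 0 < ξ := hT.trans hTξ
  have h1 := neg_one_lt_relErr hβ hT hTξ hη hstep hτ 0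
  have h2 : 0 < min 1 (1 + relErr β T η ξ τ₀ 0) := lt_min one_pos (by linarith)
  have h3 := kap_pos hT hTξ
  have : 0 < η * ξ⁻¹ * kap T ξ * min 1 (1 + relErr β T η ξ τ₀ 0) := by positivity
  unfold rateBound; linarith

/-- As `0 ≤ q ≤ 1`, a nonnegative error stays nonnegative and a negative one can only move towards
`0`. This keeps `1 + λ_k` away from `0` and makes `rateBound` valid for all times. -/
lemma min_relErr_le (hβ : 0 < β) (hT : 0 < T) (hTξ : T < ξ) (hη : 0 < η)
    (hstep : η * ξ⁻¹ ≤ 1 / stepBound ξ T) (hτ : 0 < τ₀) (k : ℕ) :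
    min 0 (relErr β T η ξ τ₀ 0) ≤ relErr β T η ξ τ₀ k := by
  have hξ : 0 < ξ := hT.trans hTξ
  induction k with
  | zero => exact min_le_right _ _
  | succ k ih =>
    have h0 := contraction_relErr_nonneg hβ hT hTξ hη hstep hτ k
    have hl := neg_one_lt_relErr hβ hT hTξ hη hstep hτ k
    have h1 := contraction_le (rate_lt_one hT hTξ hstep) (by positivity) (kap_pos hT hTξ)
      (kap_lt_one hT hTξ) hl
    have h2 : 0 ≤ η * ξ⁻¹ * kap T ξ * min 1 (1 + relErr β T η ξ τ₀ k) := by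
      have := kap_pos hT hTξ
      have : 0 ≤ min 1 (1 + relErr β T η ξ τ₀ k) := le_min zero_le_one (by linarith)
      positivity
    rw [relErr_succ hβ hT hTξ hη hstep hτ k]
    rcases le_total 0 (relErr β T η ξ τ₀ k) with h | h
    · exact (min_le_left _ _).trans (mul_nonneg h0 h)
    · refine ih.trans ?_
      nlinarith

lemma contraction_relErr_le (hβ : 0 < β) (hT : 0 < T) (hTξ : T < ξ) (hη : 0 < η)
    (hstep : η * ξ⁻¹ ≤ 1 / stepBound ξ T) (hτ : 0 < τ₀) (k : ℕ) :
    contraction (η * ξ⁻¹) (kap T ξ) (relErr β T η ξ τ₀ k) ≤ rateBound β T η ξ τ₀ := by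
  have hξ : 0 < ξ := hT.trans hTξ
  have hκ := kap_pos hT hTξ
  refine (contraction_le (rate_lt_one hT hTξ hstep) (by positivity) (kap_pos hT hTξ)
      (kap_lt_one hT hTξ) (neg_one_lt_relErr hβ hT hTξ hη hstep hτ k)).trans ?_
  unfold rateBound
  have : min 1 (1 + relErr β T η ξ τ₀ 0) ≤ min 1 (1 + relErr β T η ξ τ₀ k) := by
    have := min_relErr_le hβ hT hTξ hη hstep hτ k
    rcases min_le_iff.1 this with h | h
    · rw [min_eq_left (a := (1 : ℝ)) (b := 1 + relErr β T η ξ τ₀ k) (by linarith)]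
      exact min_le_left _ _
    · exact min_le_min le_rfl (by linarith)
  gcongr

lemma abs_relErr_succ_div_le (hβ : 0 < β) (hT : 0 < T) (hTξ : T < ξ) (hη : 0 < η)
    (hstep : η * ξ⁻¹ ≤ 1 / stepBound ξ T) (hτ : 0 < τ₀) (k : ℕ) :
    |relErr β T η ξ τ₀ (k + 1)| / |relErr β T η ξ τ₀ k| ≤ rateBound β T η ξ τ₀ := by
  have h0 := contraction_relErr_nonneg hβ hT hTξ hη hstep hτ k
  have h1 := contraction_relErr_le hβ hT hTξ hη hstep hτ k
  rw [relErr_succ hβ hT hTξ hη hstep hτ k, abs_mul, abs_of_nonneg h0]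
  rcases eq_or_ne (relErr β T η ξ τ₀ k) 0 with h | h
  -- The quotient is `0 / 0 = 0`, so what is needed is `0 ≤ rateBound`; it follows by sandwiching
  -- the contraction factor.
  · simpa [h] using (h ▸ h0).trans (h ▸ h1)
  · rw [mul_div_assoc, div_self (abs_ne_zero.2 h), mul_one]; exact h1

lemma relErr_succ_eq_zero (hβ : 0 < β) (hT : 0 < T) (hTξ : T < ξ) (hη : 0 < η)
    (hstep : η * ξ⁻¹ ≤ 1 / stepBound ξ T) (hτ : 0 < τ₀) {k : ℕ}
    (h : relErr β T η ξ τ₀ k = 0) : relErr β T η ξ τ₀ (k + 1) = 0 := by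
  rw [relErr_succ hβ hT hTξ hη hstep hτ k, h, mul_zero]

lemma relErr_eq_zero_of_le (hβ : 0 < β) (hT : 0 < T) (hTξ : T < ξ) (hη : 0 < η)
    (hstep : η * ξ⁻¹ ≤ 1 / stepBound ξ T) (hτ : 0 < τ₀) {k m : ℕ} (hkm : k ≤ m)
    (h : relErr β T η ξ τ₀ k = 0) : relErr β T η ξ τ₀ m = 0 := by
  induction m, hkm using Nat.le_induction with
  | base => exact h
  | succ m _ ih => exact relErr_succ_eq_zero hβ hT hTξ hη hstep hτ ih

lemma tendsto_relErr_ratio (hβ : 0 < β) (hT : 0 < T) (hTξ : T < ξ) (hη : 0 < η)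
    (hstep : η * ξ⁻¹ ≤ 1 / stepBound ξ T) (hτ : 0 < τ₀)
    (hlim : Tendsto (relErr β T η ξ τ₀) atTop (𝓝 0)) :
    (∀ᶠ k in atTop, relErr β T η ξ τ₀ k = 0) ∨
      Tendsto (fun k => relErr β T η ξ τ₀ (k + 1) / relErr β T η ξ τ₀ k) atTop
        (𝓝 (asympRate T η ξ)) := by
  by_cases h : ∃ k, relErr β T η ξ τ₀ k = 0
  · obtain ⟨k, hk⟩ := h
    exact .inl (eventually_atTop.2
      ⟨k, fun m hm => relErr_eq_zero_of_le hβ hT hTξ hη hstep hτ hm hk⟩)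
  · push Not at h
    right
    rw [asympRate_eq_contraction]
    refine (continuousAt_contraction_zero.tendsto.comp hlim).congr fun k => ?_
    rw [relErr_succ hβ hT hTξ hη hstep hτ k, mul_div_cancel_right₀ _ (h k)]
    rfl

end Params

end BRWP

namespace BRWP

/-! ### Total variation and the Hellinger affinity -/

section TV

variable {α : Type*} [MeasurableSpace α]

lemma integral_mul_sq_le {μ : Measure α} {f g : α → ℝ} (hf0 : 0 ≤ f) (hg0 : 0 ≤ g)
    (hf : MemLp f 2 μ) (hg : MemLp g 2 μ) :
    (∫ x, f x * g x ∂μ) ^ 2 ≤ (∫ x, f x ^ 2 ∂μ) * ∫ x, g x ^ 2 ∂μ := by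
  have h := integral_mul_le_Lp_mul_Lq_of_nonneg (μ := μ) Real.HolderConjugate.two_two
    (ae_of_all _ hf0) (ae_of_all _ hg0) (by simpa using hf) (by simpa using hg)
  simp only [Real.rpow_two, ← Real.sqrt_eq_rpow] at h
  have h0 : 0 ≤ ∫ x, f x * g x ∂μ := integral_nonneg fun x => mul_nonneg (hf0 x) (hg0 x)
  have hF : 0 ≤ ∫ x, f x ^ 2 ∂μ := integral_nonneg fun x => sq_nonneg _
  have hG : 0 ≤ ∫ x, g x ^ 2 ∂μ := integral_nonneg fun x => sq_nonneg _
  calc (∫ x, f x * g x ∂μ) ^ 2 ≤ (√(∫ x, f x ^ 2 ∂μ) * √(∫ x, g x ^ 2 ∂μ)) ^ 2 := by gcongr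
    _ = _ := by rw [mul_pow, Real.sq_sqrt hF, Real.sq_sqrt hG]

lemma tv_le_of_forall {P Q : Measure α} {b : ℝ}
    (h : ∀ A, MeasurableSet A → |P.real A - Q.real A| ≤ b) : tv P Q ≤ b := by
  have : Nonempty {A : Set α // MeasurableSet A} := ⟨⟨∅, .empty⟩⟩
  exact ciSup_le fun A => h A.1 A.2

lemma tv_le_one (P Q : Measure α) [IsProbabilityMeasure P] [IsProbabilityMeasure Q] :
    tv P Q ≤ 1 :=
  tv_le_of_forall fun A _ => by
    rw [abs_le]
    constructor <;>
      linarith [measureReal_nonneg (μ := P) (s := A), measureReal_nonneg (μ := Q) (s := A),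
        measureReal_le_one (μ := P) (s := A), measureReal_le_one (μ := Q) (s := A)]

/-- If `f²` and `g²` are probability densities, then the squared difference of the probabilities of
any event is at most `1 - (∫ f g)²`. -/
lemma sq_sub_setIntegral_le {μ : Measure α} {f g : α → ℝ} (hf0 : 0 ≤ f) (hg0 : 0 ≤ g)
    (hf : MemLp f 2 μ) (hg : MemLp g 2 μ) (hf1 : ∫ x, f x ^ 2 ∂μ = 1) (hg1 : ∫ x, g x ^ 2 ∂μ = 1)
    {A : Set α} (hA : MeasurableSet A) :
    (∫ x in A, f x ^ 2 ∂μ - ∫ x in A, g x ^ 2 ∂μ) ^ 2 ≤ 1 - (∫ x, f x * g x ∂μ) ^ 2 := by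
  have hfi : Integrable (fun x => f x ^ 2) μ := hf.integrable_sq
  have hgi : Integrable (fun x => g x ^ 2) μ := hg.integrable_sq
  have hfg : Integrable (fun x => f x * g x) μ := hf.integrable_mul hg
  have hdi : Integrable (fun x => f x ^ 2 - g x ^ 2) μ := hfi.sub hgi
  have hsub : ∫ x in A, f x ^ 2 ∂μ - ∫ x in A, g x ^ 2 ∂μ = ∫ x in A, (f x ^ 2 - g x ^ 2) ∂μ :=
    (integral_sub hfi.integrableOn hgi.integrableOn).symm
  have htot : ∫ x in A, (f x ^ 2 - g x ^ 2) ∂μ + ∫ x in Aᶜ, (f x ^ 2 - g x ^ 2) ∂μ = 0 := by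
    rw [integral_add_compl hA hdi, integral_sub hfi hgi, hf1, hg1, sub_self]
  have habs : ∫ x in A, |f x ^ 2 - g x ^ 2| ∂μ + ∫ x in Aᶜ, |f x ^ 2 - g x ^ 2| ∂μ =
      ∫ x, |f x - g x| * (f x + g x) ∂μ := by
    rw [integral_add_compl hA hdi.abs]
    refine integral_congr_ae (ae_of_all _ fun x => ?_)
    have : f x ^ 2 - g x ^ 2 = (f x - g x) * (f x + g x) := by ring
    simp only [this, abs_mul, abs_of_nonneg (add_nonneg (hf0 x) (hg0 x))]
  have h1 := abs_integral_le_integral_abs (μ := μ.restrict A) (f := fun x => f x ^ 2 - g x ^ 2)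
  have h2 := abs_integral_le_integral_abs (μ := μ.restrict Aᶜ) (f := fun x => f x ^ 2 - g x ^ 2)
  -- The signed density has total mass zero, so `A` and its complement contribute equally in
  -- absolute value. This doubles the left side and matches the factor `4` in `(2 - 2ρ)(2 + 2ρ) = 4
  -- (1 - ρ²)`, where `ρ = ∫ f g`.
  have h3 : ∫ x in Aᶜ, (f x ^ 2 - g x ^ 2) ∂μ = -∫ x in A, (f x ^ 2 - g x ^ 2) ∂μ := by linarith
  rw [h3, abs_neg] at h2
  have hCS := integral_mul_sq_le (μ := μ) (f := fun x => |f x - g x|) (g := fun x => f x + g x)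
    (fun x => abs_nonneg _) (fun x => add_nonneg (hf0 x) (hg0 x)) (hf.sub hg).abs (hf.add hg)
  have hm : ∫ x, |f x - g x| ^ 2 ∂μ = 2 - 2 * ∫ x, f x * g x ∂μ := by
    have : (fun x => |f x - g x| ^ 2) = fun x => f x ^ 2 + g x ^ 2 - 2 * (f x * g x) := by
      ext x; rw [sq_abs]; ring
    rw [this, integral_sub (by exact hfi.add hgi) (hfg.const_mul 2), integral_add hfi hgi, hf1, hg1,
      integral_const_mul]
    norm_num
  have hp : ∫ x, (f x + g x) ^ 2 ∂μ = 2 + 2 * ∫ x, f x * g x ∂μ := by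
    have : (fun x => (f x + g x) ^ 2) = fun x => f x ^ 2 + g x ^ 2 + 2 * (f x * g x) := by
      ext x; ring
    rw [this, integral_add (by exact hfi.add hgi) (hfg.const_mul 2), integral_add hfi hgi, hf1, hg1,
      integral_const_mul]
    norm_num
  rw [hm, hp, ← habs] at hCS
  rw [hsub]
  have h5 : (2 * |∫ x in A, (f x ^ 2 - g x ^ 2) ∂μ|) ^ 2 ≤
      (∫ x in A, |f x ^ 2 - g x ^ 2| ∂μ + ∫ x in Aᶜ, |f x ^ 2 - g x ^ 2| ∂μ) ^ 2 := by
    have : 2 * |∫ x in A, (f x ^ 2 - g x ^ 2) ∂μ| ≤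
      ∫ x in A, |f x ^ 2 - g x ^ 2| ∂μ + ∫ x in Aᶜ, |f x ^ 2 - g x ^ 2| ∂μ := by linarith
    gcongr
  rw [mul_pow, sq_abs] at h5
  linarith

end TV

lemma one_sub_prod_le_sum_one_sub {ι : Type*} (s : Finset ι) (b : ι → ℝ)
    (h0 : ∀ i ∈ s, 0 ≤ b i) (h1 : ∀ i ∈ s, b i ≤ 1) :
    1 - ∏ i ∈ s, b i ≤ ∑ i ∈ s, (1 - b i) := by
  classical
  induction s using Finset.induction_on with
  | empty => simp
  | insert j s hj ih =>
    rw [Finset.prod_insert hj, Finset.sum_insert hj]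
    have ih' := ih (fun i hi => h0 i (Finset.mem_insert_of_mem hi))
      (fun i hi => h1 i (Finset.mem_insert_of_mem hi))
    have hP : ∏ i ∈ s, b i ≤ 1 := Finset.prod_le_one
      (fun i hi => h0 i (Finset.mem_insert_of_mem hi))
      (fun i hi => h1 i (Finset.mem_insert_of_mem hi))
    have := h1 j (Finset.mem_insert_self _ _)
    nlinarith [mul_nonneg (sub_nonneg.2 this) (sub_nonneg.2 hP)]

/-! ### Centred Gaussians with diagonal covariance -/

lemma integral_exp_neg_mul_sub_sq (A c : ℝ) :
    ∫ y : ℝ, Real.exp (-A * (y - c) ^ 2) = √(Real.pi / A) := by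
  rw [integral_sub_right_eq_self (fun y : ℝ => Real.exp (-A * y ^ 2)) c, integral_gaussian]

/-- The density of the centred Gaussian of variance `v`. -/
noncomputable def centredPDF (v x : ℝ) : ℝ := gaussianPDFReal 0 v.toNNReal x

lemma centredPDF_nonneg (v x : ℝ) : 0 ≤ centredPDF v x := gaussianPDFReal_nonneg _ _ _

lemma centredPDF_eq {v : ℝ} (hv : 0 < v) (x : ℝ) :
    centredPDF v x = (√(2 * Real.pi * v))⁻¹ * Real.exp (-x ^ 2 / (2 * v)) := by
  simp [centredPDF, gaussianPDFReal, hv.le]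

lemma sq_integral_sqrt_mul_sqrt {s t : ℝ} (hs : 0 < s) (ht : 0 < t) :
    (∫ x, √(centredPDF s x) * √(centredPDF t x)) ^ 2 = 2 * √(s * t) / (s + t) := by
  have hπ := Real.pi_pos
  have h : ∀ x, √(centredPDF s x) * √(centredPDF t x) =
      √((√(2 * Real.pi * s))⁻¹ * (√(2 * Real.pi * t))⁻¹) *
        Real.exp (-((s + t) / (4 * (s * t))) * (x - 0) ^ 2) := by
    intro x
    rw [← Real.sqrt_mul (centredPDF_nonneg _ _), centredPDF_eq hs, centredPDF_eq ht]
    have : (√(2 * Real.pi * s))⁻¹ * Real.exp (-x ^ 2 / (2 * s)) *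
        ((√(2 * Real.pi * t))⁻¹ * Real.exp (-x ^ 2 / (2 * t))) =
        ((√(2 * Real.pi * s))⁻¹ * (√(2 * Real.pi * t))⁻¹) *
          Real.exp (-((s + t) / (4 * (s * t))) * (x - 0) ^ 2) ^ 2 := by
      rw [mul_mul_mul_comm, ← Real.exp_add, ← Real.exp_nat_mul]
      congr 2
      push_cast
      field_simp
      ring
    rw [this, Real.sqrt_mul (by positivity), Real.sqrt_sq (Real.exp_pos _).le]
  simp_rw [h]
  rw [integral_const_mul, integral_exp_neg_mul_sub_sq, mul_pow, Real.sq_sqrt (by positivity),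
    Real.sq_sqrt (by positivity), ← mul_inv, ← Real.sqrt_mul (by positivity),
    show 2 * Real.pi * s * (2 * Real.pi * t) = (2 * Real.pi) ^ 2 * (s * t) by ring,
    Real.sqrt_mul (by positivity), Real.sqrt_sq (by positivity)]
  have h1 : √(s * t) ≠ 0 := by positivity
  field_simp
  rw [Real.sq_sqrt (by positivity)]
  ring

/-- With `s = p²` and `t = q²`, both sides carry the factor `(p - q)²`; what remains is `q⁴ ≤ (p² +
q²)(p + q)²`, clear on expanding. -/
lemma one_sub_affinity_le {s t : ℝ} (hs : 0 < s) (ht : 0 < t) :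
    1 - 2 * √(s * t) / (s + t) ≤ ((s - t) / t) ^ 2 := by
  obtain ⟨p, hp, rfl⟩ : ∃ p : ℝ, 0 < p ∧ s = p ^ 2 :=
    ⟨√s, Real.sqrt_pos.2 hs, (Real.sq_sqrt hs.le).symm⟩
  obtain ⟨q, hq, rfl⟩ : ∃ q : ℝ, 0 < q ∧ t = q ^ 2 :=
    ⟨√t, Real.sqrt_pos.2 ht, (Real.sq_sqrt ht.le).symm⟩
  rw [← mul_pow, Real.sqrt_sq (by positivity)]
  have h1 : 1 - 2 * (p * q) / (p ^ 2 + q ^ 2) = (p - q) ^ 2 / (p ^ 2 + q ^ 2) := by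
    field_simp; ring
  have h2 : ((p ^ 2 - q ^ 2) / q ^ 2) ^ 2 = (p - q) ^ 2 * ((p + q) ^ 2 / (q ^ 2) ^ 2) := by
    field_simp; ring
  rw [h1, h2, div_eq_mul_inv]
  gcongr
  rw [inv_le_comm₀ (by positivity) (by positivity), inv_div, div_le_iff₀ (by positivity)]
  nlinarith [sq_nonneg p, mul_pos hp hq, mul_pos (pow_pos hp 2) (pow_pos hq 2),
    mul_pos (mul_pos hp hq) (pow_pos hq 2), pow_pos hp 4, mul_pos hp (pow_pos hq 3), mul_pos hq (pow_pos hp 3)]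

variable {d : ℕ}

lemma integral_centredPDF {v : ℝ} (hv : 0 < v) : ∫ x, centredPDF v x = 1 :=
  integral_gaussianPDFReal_eq_one _ (by simpa using hv)

lemma measurable_centredPDF (v : ℝ) : Measurable (centredPDF v) := measurable_gaussianPDFReal _ _

lemma integrable_prod_centredPDF (v : Fin d → ℝ) :
    Integrable (fun x : Fin d → ℝ => ∏ i, centredPDF (v i) (x i)) :=
  Integrable.fintype_prod fun _ => integrable_gaussianPDFReal _ _

lemma pi_gaussianReal_eq_withDensity {v : Fin d → ℝ} (hv : ∀ i, 0 < v i) :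
    Measure.pi (fun i => gaussianReal 0 (v i).toNNReal) =
      volume.withDensity (fun x => ENNReal.ofReal (∏ i, centredPDF (v i) (x i))) := by
  refine Measure.pi_eq fun s hs => ?_
  have hv' : ∀ i, (v i).toNNReal ≠ 0 := fun i => by simpa using hv i
  rw [withDensity_apply _ (.univ_pi hs), ← ofReal_integral_eq_lintegral_ofReal
    (integrable_prod_centredPDF v).restrict
    (ae_of_all _ fun x => Finset.prod_nonneg fun i _ => centredPDF_nonneg _ _)]
  simp_rw [gaussianReal_apply_eq_integral 0 (hv' _)]
  rw [← ENNReal.ofReal_prod_of_nonneg fun i _ => integral_nonneg fun x => gaussianPDFReal_nonneg _ _ _,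
    volume_pi, Measure.restrict_pi_pi, integral_fintype_prod_eq_prod]
  rfl

lemma posSemidef_diagonal {v : Fin d → ℝ} (hv : ∀ i, 0 ≤ v i) :
    (Matrix.diagonal v).PosSemidef := Matrix.posSemidef_diagonal_iff.2 hv

/-- Characteristic functions agree. The product form lets integrals against the Gaussian split into
one-dimensional ones. -/
lemma diagGaussian_eq_map_pi {v : Fin d → ℝ} (hv : ∀ i, 0 ≤ v i) :
    diagGaussian v =
      (Measure.pi fun i => gaussianReal 0 (v i).toNNReal).map (WithLp.toLp 2) := by
  unfold diagGaussian
  have : IsProbabilityMeasure ((Measure.pi fun i => gaussianReal 0 (v i).toNNReal).map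
      (WithLp.toLp 2 : (Fin d → ℝ) → E d)) :=
    Measure.isProbabilityMeasure_map (by fun_prop)
  apply Measure.ext_of_charFun (E := E d)
  ext t
  rw [charFun_pi, charFun_multivariateGaussian (posSemidef_diagonal hv)]
  simp_rw [charFun_gaussianReal, ← Complex.exp_sum]
  congr 1
  simp [dotProduct, Matrix.mulVec_diagonal, hv, Finset.sum_div]
  refine Finset.sum_congr rfl fun i _ => ?_
  ring

instance (v : Fin d → ℝ) : IsProbabilityMeasure (diagGaussian v) := by
  unfold diagGaussian; infer_instance

/-- Square roots of the densities serve as `f` and `g` in `sq_sub_setIntegral_le`. Their squared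
affinity is a product of numbers in `[0, 1]`, and one minus such a product is at most the sum of the
one-dimensional deficits. -/
lemma tv_diagGaussian_le {v u : Fin d → ℝ} (hv : ∀ i, 0 < v i) (hu : ∀ i, 0 < u i) :
    tv (diagGaussian v) (diagGaussian u) ≤ √(∑ i, ((v i - u i) / u i) ^ 2) := by
  refine tv_le_of_forall fun A hA => Real.abs_le_sqrt ?_
  set B : Set (Fin d → ℝ) := WithLp.toLp 2 ⁻¹' A
  have hm : Measurable (WithLp.toLp 2 : (Fin d → ℝ) → E d) := by fun_prop
  have hB : MeasurableSet B := hm hA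
  let f : (Fin d → ℝ) → (Fin d → ℝ) → ℝ := fun v x => ∏ i, √(centredPDF (v i) (x i))
  have hf0 : ∀ v, 0 ≤ f v := fun v x => Finset.prod_nonneg fun i _ => Real.sqrt_nonneg _
  have hsq : ∀ v x, f v x ^ 2 = ∏ i, centredPDF (v i) (x i) := fun v x => by
    simp only [f, ← Finset.prod_pow, Real.sq_sqrt (centredPDF_nonneg _ _)]
  have hfm : ∀ v, Measurable (f v) := fun v => Finset.measurable_fun_prod _ fun i _ =>
    ((measurable_centredPDF (v i)).comp (measurable_pi_apply i)).sqrt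
  have hL : ∀ v, MemLp (f v) 2 volume := fun v => by
    rw [memLp_two_iff_integrable_sq (hfm v).aestronglyMeasurable]
    simp_rw [hsq]
    exact integrable_prod_centredPDF v
  have h1 : ∀ v : Fin d → ℝ, (∀ i, 0 < v i) → ∫ x, f v x ^ 2 = 1 := fun v hv => by
    simp_rw [hsq]
    rw [integral_fintype_prod_volume_eq_prod]
    exact Finset.prod_eq_one fun i _ => integral_centredPDF (hv i)
  have hreal : ∀ v : Fin d → ℝ, (∀ i, 0 < v i) → (diagGaussian v).real A = ∫ x in B, f v x ^ 2 := by
    intro v hv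
    simp_rw [hsq]
    rw [Measure.real, diagGaussian_eq_map_pi fun i => (hv i).le, Measure.map_apply hm hA,
      pi_gaussianReal_eq_withDensity hv, withDensity_apply _ hB,
      ← ofReal_integral_eq_lintegral_ofReal (integrable_prod_centredPDF v).restrict
        (ae_of_all _ fun x => Finset.prod_nonneg fun i _ => centredPDF_nonneg _ _),
      ENNReal.toReal_ofReal (integral_nonneg fun x => Finset.prod_nonneg fun i _ =>
        centredPDF_nonneg _ _)]
  rw [hreal v hv, hreal u hu]
  refine (sq_sub_setIntegral_le (hf0 v) (hf0 u) (hL v) (hL u) (h1 v hv) (h1 u hu) hB).trans ?_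
  have haff : (∫ x, f v x * f u x) ^ 2 = ∏ i, (2 * √(v i * u i) / (v i + u i)) := by
    simp only [f, ← Finset.prod_mul_distrib]
    rw [integral_fintype_prod_volume_eq_prod
      (f := fun i y => √(centredPDF (v i) y) * √(centredPDF (u i) y)), ← Finset.prod_pow]
    exact Finset.prod_congr rfl fun i _ => sq_integral_sqrt_mul_sqrt (hv i) (hu i)
  rw [haff]
  refine (one_sub_prod_le_sum_one_sub _ _ (fun i _ => ?_) (fun i _ => ?_)).trans
    (Finset.sum_le_sum fun i _ => one_sub_affinity_le (hv i) (hu i))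
  · have := hv i; have := hu i; positivity
  · have hvi := hv i
    have hui := hu i
    rw [div_le_one (by positivity), Real.sqrt_mul hvi.le]
    nlinarith [sq_nonneg (√(v i) - √(u i)), Real.sq_sqrt hvi.le, Real.sq_sqrt hui.le]

lemma diagGaussian_map_mul {v : Fin d → ℝ} (hv : ∀ i, 0 ≤ v i) (g : Fin d → ℝ) :
    (diagGaussian v).map (fun x => WithLp.toLp 2 fun i => g i * x i) =
      diagGaussian fun i => g i ^ 2 * v i := by
  have hm : Measurable (WithLp.toLp 2 : (Fin d → ℝ) → E d) := by fun_prop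
  rw [diagGaussian_eq_map_pi hv, diagGaussian_eq_map_pi fun i => mul_nonneg (sq_nonneg _) (hv i),
    Measure.map_map (by fun_prop) hm]
  have h1 : (fun x : E d => (WithLp.toLp 2 fun i => g i * x i : E d)) ∘ WithLp.toLp 2 =
      WithLp.toLp 2 ∘ fun x : Fin d → ℝ => fun i => g i * x i := rfl
  rw [h1, ← Measure.map_map hm (by fun_prop)]
  congr 1
  rw [Measure.pi_map_pi (f := fun i y => g i * y) fun i => by fun_prop]
  congr 1
  ext1 i
  rw [gaussianReal_map_const_mul, mul_zero]
  congr 1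
  ext
  have := hv i
  have : 0 ≤ g i ^ 2 * v i := by positivity
  simp [*]

lemma diagGaussian_injective {v u : Fin d → ℝ} (hv : ∀ i, 0 ≤ v i) (hu : ∀ i, 0 ≤ u i)
    (h : diagGaussian v = diagGaussian u) : v = u := by
  ext i
  have h1 := variance_eval_multivariateGaussian (μ := 0) (posSemidef_diagonal hv) i
  have h2 := variance_eval_multivariateGaussian (μ := 0) (posSemidef_diagonal hu) i
  unfold diagGaussian at h
  rw [h, h2] at h1
  simpa using h1.symm

end BRWP

namespace BRWP

/-! ### The regularized Wasserstein proximal of a diagonal Gaussian -/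

variable {d : ℕ}

lemma inv_diagonal_of_ne_zero {v : Fin d → ℝ} (hv : ∀ i, v i ≠ 0) :
    (Matrix.diagonal v)⁻¹ = Matrix.diagonal fun i => (v i)⁻¹ := by
  refine Matrix.inv_eq_right_inv ?_
  rw [Matrix.diagonal_mul_diagonal, ← Matrix.diagonal_one]
  congr 1
  ext i
  exact mul_inv_cancel₀ (hv i)

lemma quadraticPotential_diagonal {ξ : Fin d → ℝ} (hξ : ∀ i, ξ i ≠ 0) (x : E d) :
    quadraticPotential (Matrix.diagonal ξ) x = ∑ i, (1 / 2) * (ξ i)⁻¹ * x i ^ 2 := by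
  unfold quadraticPotential
  rw [inv_diagonal_of_ne_zero hξ, dotProduct, Finset.mul_sum]
  refine Finset.sum_congr rfl fun i _ => ?_
  rw [Matrix.mulVec_diagonal]
  ring

lemma hasGradientAt_sum_sq (a : Fin d → ℝ) (b : ℝ) (x : E d) :
    HasGradientAt (fun z : E d => b + ∑ i, (1 / 2) * a i * z i ^ 2)
      (WithLp.toLp 2 fun i => a i * x i) x := by
  rw [hasGradientAt_iff_hasFDerivAt]
  have h : HasFDerivAt (fun z : E d => b + ∑ i, (1 / 2) * a i * z i ^ 2)
      (∑ i, ((1 / 2) * a i) • ((2 * x i) • (EuclideanSpace.proj i : E d →L[ℝ] ℝ))) x := by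
    refine HasFDerivAt.const_add b (HasFDerivAt.fun_sum fun i _ => HasFDerivAt.const_mul ?_ _)
    have := ((EuclideanSpace.proj i : E d →L[ℝ] ℝ).hasFDerivAt (x := x)).pow 2
    simpa using this
  refine h.congr_fderiv ?_
  ext z
  simp only [_root_.sum_apply, _root_.smul_apply, EuclideanSpace.coe_proj, smul_eq_mul,
    InnerProductSpace.toDual_apply_apply, PiLp.inner_apply]
  refine Finset.sum_congr rfl fun i _ => ?_
  simp
  ring

/-- The slope of the conditional mean of the proximal kernel in one coordinate. -/
noncomputable def condSlope (T ξ : ℝ) : ℝ := ξ / (ξ + T)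

/-- The conditional variance of the proximal kernel in one coordinate. -/
noncomputable def condVar (β T ξ : ℝ) : ℝ := 2 * β * T * ξ / (ξ + T)

lemma condVar_pos {β T ξ : ℝ} (hβ : 0 < β) (hT : 0 < T) (hξ : 0 < ξ) : 0 < condVar β T ξ := by
  unfold condVar; positivity

/-- Completing the square in `x` isolates a factor depending on `y` alone, which the normalisation
of the kernel cancels. -/
lemma exp_kernel_coord {β T ξ : ℝ} (hβ : 0 < β) (hT : 0 < T) (hξ : 0 < ξ) (x y : ℝ) :
    Real.exp (-(1 / (2 * β)) * ((1 / 2) * ξ⁻¹ * x ^ 2 + (x - y) ^ 2 / (2 * T))) =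
      Real.exp (-y ^ 2 / (4 * β * (ξ + T))) *
        Real.exp (-(1 / (2 * condVar β T ξ)) * (x - condSlope T ξ * y) ^ 2) := by
  rw [← Real.exp_add]
  congr 1
  unfold condVar condSlope
  field_simp
  ring

lemma integral_euclidean_prod (f : Fin d → ℝ → ℝ) :
    ∫ x : E d, ∏ i, f i (x i) = ∏ i, ∫ y, f i y := by
  rw [← integral_fintype_prod_volume_eq_prod,
    ← (PiLp.volume_preserving_toLp (Fin d)).integral_comp
      (MeasurableEquiv.toLp 2 (Fin d → ℝ)).measurableEmbedding]

lemma kernelNum_diagonal {ξ : Fin d → ℝ} {β T : ℝ} (hξ : ∀ i, 0 < ξ i) (hβ : 0 < β) (hT : 0 < T)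
    (x y : E d) :
    kernelNum (quadraticPotential (Matrix.diagonal ξ)) β T x y =
      ∏ i, (Real.exp (-y i ^ 2 / (4 * β * (ξ i + T))) *
        Real.exp (-(1 / (2 * condVar β T (ξ i))) * (x i - condSlope T (ξ i) * y i) ^ 2)) := by
  unfold kernelNum
  rw [quadraticPotential_diagonal fun i => (hξ i).ne', EuclideanSpace.real_norm_sq_eq,
    Finset.sum_div, ← Finset.sum_add_distrib, Finset.mul_sum, Real.exp_sum]
  exact Finset.prod_congr rfl fun i _ => exp_kernel_coord hβ hT (hξ i) _ _

lemma kernel_diagonal {ξ : Fin d → ℝ} {β T : ℝ} (hξ : ∀ i, 0 < ξ i) (hβ : 0 < β) (hT : 0 < T)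
    (x y : E d) :
    kernel (quadraticPotential (Matrix.diagonal ξ)) β T x y =
      ∏ i, ((√(Real.pi / (1 / (2 * condVar β T (ξ i)))))⁻¹ *
        Real.exp (-(1 / (2 * condVar β T (ξ i))) * (x i - condSlope T (ξ i) * y i) ^ 2)) := by
  unfold kernel
  simp_rw [kernelNum_diagonal hξ hβ hT]
  rw [integral_euclidean_prod (fun i z => Real.exp (-y i ^ 2 / (4 * β * (ξ i + T))) *
        Real.exp (-(1 / (2 * condVar β T (ξ i))) * (z - condSlope T (ξ i) * y i) ^ 2)),
    ← Finset.prod_div_distrib]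
  refine Finset.prod_congr rfl fun i _ => ?_
  rw [integral_const_mul, integral_exp_neg_mul_sub_sq, mul_div_mul_left _ _ (Real.exp_ne_zero _),
    div_eq_inv_mul]

/-- The variance in one coordinate of the proximal of a centred Gaussian of variance `v`. -/
noncomputable def proxVar (β T ξ v : ℝ) : ℝ := condSlope T ξ ^ 2 * v + condVar β T ξ

lemma proxVar_pos {β T ξ v : ℝ} (hβ : 0 < β) (hT : 0 < T) (hξ : 0 < ξ) (hv : 0 < v) :
    0 < proxVar β T ξ v := by
  have := condVar_pos hβ hT hξ
  unfold proxVar; positivity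

lemma integral_exp_gaussianReal {m b v : ℝ} (hb : 0 < b) (hv : 0 < v) :
    ∃ C : ℝ, 0 < C ∧ ∀ x : ℝ,
      ∫ y, Real.exp (-(1 / (2 * b)) * (x - m * y) ^ 2) ∂(gaussianReal 0 v.toNNReal) =
        C * Real.exp (-(1 / (2 * (m ^ 2 * v + b))) * x ^ 2) := by
  have hs : 0 < m ^ 2 * v + b := by positivity
  have hA : 0 < (m ^ 2 * v + b) / (2 * b * v) := by positivity
  have hπ := Real.pi_pos
  refine ⟨(√(2 * Real.pi * v))⁻¹ * √(Real.pi / ((m ^ 2 * v + b) / (2 * b * v))), by positivity,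
    fun x => ?_⟩
  rw [integral_gaussianReal_eq_integral_smul (by simpa using hv)]
  have h : ∀ y, gaussianPDFReal 0 v.toNNReal y • Real.exp (-(1 / (2 * b)) * (x - m * y) ^ 2) =
      ((√(2 * Real.pi * v))⁻¹ * Real.exp (-(1 / (2 * (m ^ 2 * v + b))) * x ^ 2)) *
        Real.exp (-((m ^ 2 * v + b) / (2 * b * v)) * (y - m * v / (m ^ 2 * v + b) * x) ^ 2) := by
    intro y
    rw [← centredPDF, centredPDF_eq hv, smul_eq_mul, mul_assoc, mul_assoc (√_)⁻¹,
      ← Real.exp_add, ← Real.exp_add]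
    congr 2
    have := hs.ne'
    field_simp
    ring
  simp_rw [h]
  rw [integral_const_mul, integral_exp_neg_mul_sub_sq]
  ring

/-- The constant is left unspecified because the scheme only sees the gradient of the logarithm. -/
lemma wproxDensity_diagGaussian {ξ v : Fin d → ℝ} {β T : ℝ} (hξ : ∀ i, 0 < ξ i) (hβ : 0 < β)
    (hT : 0 < T) (hv : ∀ i, 0 < v i) :
    ∃ C : ℝ, 0 < C ∧ ∀ x : E d,
      wproxDensity (quadraticPotential (Matrix.diagonal ξ)) β T (diagGaussian v) x =
        C * Real.exp (-∑ i, (1 / (2 * proxVar β T (ξ i) (v i))) * x i ^ 2) := by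
  choose C hC hCx using fun i => integral_exp_gaussianReal (m := condSlope T (ξ i))
    (condVar_pos hβ hT (hξ i)) (hv i)
  have hb := fun i => condVar_pos hβ hT (hξ i)
  have hπ := Real.pi_pos
  refine ⟨∏ i, ((√(Real.pi / (1 / (2 * condVar β T (ξ i)))))⁻¹ * C i),
    Finset.prod_pos fun i _ => ?_, fun x => ?_⟩
  · have := hb i
    have := hC i
    positivity
  unfold wproxDensity
  simp_rw [kernel_diagonal hξ hβ hT]
  rw [diagGaussian_eq_map_pi fun i => (hv i).le, ← MeasurableEquiv.coe_toLp, integral_map_equiv]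
  simp only [MeasurableEquiv.coe_toLp]
  rw [integral_fintype_prod_eq_prod (f := fun i y =>
    (√(Real.pi / (1 / (2 * condVar β T (ξ i)))))⁻¹ *
        Real.exp (-(1 / (2 * condVar β T (ξ i))) * (x i - condSlope T (ξ i) * y) ^ 2)),
    ← Finset.sum_neg_distrib, Real.exp_sum, ← Finset.prod_mul_distrib]
  refine Finset.prod_congr rfl fun i _ => ?_
  rw [integral_const_mul, hCx, proxVar, neg_mul, mul_assoc]

/-- On a centred diagonal Gaussian, one particle update is a diagonal linear map. -/
lemma stepMap_diagGaussian {ξ v : Fin d → ℝ} {β T η : ℝ} (hξ : ∀ i, 0 < ξ i) (hβ : 0 < β)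
    (hT : 0 < T) (hv : ∀ i, 0 < v i) :
    stepMap (quadraticPotential (Matrix.diagonal ξ)) β T η (diagGaussian v) =
      fun x => WithLp.toLp 2 fun i => stepFactor β T η (ξ i) (v i) * x i := by
  obtain ⟨C, hC, hρ⟩ := wproxDensity_diagGaussian hξ hβ hT hv
  funext x
  have h1 : gradient (quadraticPotential (Matrix.diagonal ξ)) x =
      WithLp.toLp 2 fun i => (ξ i)⁻¹ * x i := by
    have h := (hasGradientAt_sum_sq (fun i => (ξ i)⁻¹) 0 x).gradient
    rw [← h]
    congr 1
    funext z
    rw [quadraticPotential_diagonal fun i => (hξ i).ne', zero_add]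
  have h2 : gradient (fun z => Real.log
      (wproxDensity (quadraticPotential (Matrix.diagonal ξ)) β T (diagGaussian v) z)) x =
      WithLp.toLp 2 fun i => -(1 / proxVar β T (ξ i) (v i)) * x i := by
    have h := (hasGradientAt_sum_sq (fun i => -(1 / proxVar β T (ξ i) (v i))) (Real.log C) x).gradient
    rw [← h]
    congr 1
    funext z
    rw [hρ, Real.log_mul hC.ne' (Real.exp_ne_zero _), Real.log_exp, ← Finset.sum_neg_distrib]
    congr 1
    refine Finset.sum_congr rfl fun i _ => ?_
    rw [one_div_mul_eq_div]
    have := (proxVar_pos hβ hT (hξ i) (hv i)).ne'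
    field_simp
  unfold stepMap
  rw [h1, h2]
  ext i
  have hξi := hξ i
  have hvi := hv i
  have h3 : proxVar β T (ξ i) (v i) =
      (v i + 2 * β * T * (1 + T * (ξ i)⁻¹)) / (1 + T * (ξ i)⁻¹) ^ 2 := by
    unfold proxVar condSlope condVar; field_simp
  simp only [PiLp.sub_apply, PiLp.smul_apply, smul_eq_mul, h3, stepFactor]
  rw [one_div_div]
  ring

lemma stepLaw_diagGaussian {ξ v : Fin d → ℝ} {β T η : ℝ} (hξ : ∀ i, 0 < ξ i) (hβ : 0 < β)
    (hT : 0 < T) (hv : ∀ i, 0 < v i) :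
    stepLaw (quadraticPotential (Matrix.diagonal ξ)) β T η (diagGaussian v) =
      diagGaussian fun i => stepFactor β T η (ξ i) (v i) ^ 2 * v i := by
  rw [stepLaw, stepMap_diagGaussian hξ hβ hT hv, diagGaussian_map_mul fun i => (hv i).le]

end BRWP

namespace BRWP

/-! ### The contraction factor and the mixing time -/

lemma mixingTime_le_of_tv_le {α : Type*} [MeasurableSpace α] {op : Measure α → Measure α}
    {μ₀ target : Measure α} {δ : ℝ} {k : ℕ} (h : tv (op^[k] μ₀) target ≤ δ) :
    mixingTime op μ₀ target δ ≤ k :=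
  sInf_le ⟨k, h, rfl⟩

lemma exists_mixingTime_eq {α : Type*} [MeasurableSpace α] {op : Measure α → Measure α}
    {μ₀ target : Measure α} {δ : ℝ} {m : ℕ} (h : mixingTime op μ₀ target δ ≤ m) :
    ∃ n : ℕ, mixingTime op μ₀ target δ = n ∧ n ≤ m := by
  obtain ⟨n, hn⟩ := ENat.ne_top_iff_exists.1 (ne_top_of_le_ne_top (ENat.natCast_ne_top m) h)
  refine ⟨n, hn.symm, ?_⟩
  rw [← hn] at h
  exact_mod_cast h

/-- Geometric decay at rate `c` reaches the level `δ` after `⌈log (M / δ) / log (1 / c)⌉₊` steps. -/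
lemma mul_pow_ceil_log_le {M c δ : ℝ} (hM : 0 ≤ M) (hc : 0 < c) (hc1 : c < 1) (hδ : 0 < δ) :
    M * c ^ ⌈Real.log (M / δ) / Real.log (1 / c)⌉₊ ≤ δ := by
  rcases hM.eq_or_lt with rfl | hM
  · simpa using hδ.le
  set k := ⌈Real.log (M / δ) / Real.log (1 / c)⌉₊
  have hL : 0 < Real.log (1 / c) := Real.log_pos (by rw [lt_div_iff₀ hc]; linarith)
  have h1 : Real.log (M / δ) ≤ k * Real.log (1 / c) := (div_le_iff₀ hL).1 (Nat.le_ceil _)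
  rw [← Real.log_pow, Real.log_le_log_iff (by positivity) (by positivity), one_div, inv_pow,
    div_le_iff₀ hδ, inv_mul_eq_div, le_div_iff₀ (by positivity)] at h1
  exact h1

/-- The ceiling costs at most one step, that is `log (1 / c)` in the numerator. The hypothesis on
`δ` says that `log (3/2) + log (1 / c) ≤ log (M / δ)`, so both excess terms are absorbed by a second
copy of `log (M / δ)`. -/
lemma ceil_log_le_two_mul {M c δ : ℝ} (hc : 0 < c) (hc1 : c < 1) (hδ : 0 < δ)
    (hδM : δ ≤ 2 / 3 * c * M) :
    (⌈Real.log (3 / 2 * M / δ) / Real.log (1 / c)⌉₊ : ℝ) ≤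
      2 * (Real.log (M / δ) / Real.log (1 / c)) := by
  have hM : 0 < M := by
    by_contra h
    have : 2 / 3 * c * M ≤ 0 := mul_nonpos_of_nonneg_of_nonpos (by positivity) (not_lt.1 h)
    linarith
  have hL : 0 < Real.log (1 / c) := Real.log_pos (by rw [lt_div_iff₀ hc]; linarith)
  have hge : 3 / 2 * (1 / c) ≤ M / δ := by
    rw [le_div_iff₀ hδ, mul_one_div, div_mul_eq_mul_div, div_le_iff₀ hc]
    linarith
  have hone : 1 ≤ 1 / c := by rw [le_div_iff₀ hc]; linarith
  have hpos : 0 ≤ Real.log (3 / 2 * M / δ) := by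
    refine Real.log_nonneg ?_
    rw [mul_div_assoc]
    linarith
  have h2 : Real.log (3 / 2 * M / δ) + Real.log (1 / c) ≤ 2 * Real.log (M / δ) := by
    have h3 : Real.log (3 / 2 * (1 / c)) ≤ Real.log (M / δ) :=
      Real.log_le_log (by positivity) hge
    rw [Real.log_mul (by norm_num) (by positivity)] at h3
    rw [mul_div_assoc, Real.log_mul (by norm_num) (by positivity)]
    linarith
  refine (Nat.ceil_lt_add_one (by positivity)).le.trans ?_
  rw [← mul_div_assoc, div_add_one hL.ne']
  gcongr

/-! ### All coordinates together: the worst rate, the law of the chain and its mixing. -/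

section Chain

variable {d : ℕ} {ξ τ₀ : Fin d → ℝ} {β T η : ℝ}

/-- The standing assumptions on the parameters, and positivity of the initial variances. -/
structure Admissible (β T η : ℝ) (ξ τ₀ : Fin d → ℝ) : Prop where
  beta_pos : 0 < β
  T_pos : 0 < T
  eta_pos : 0 < η
  T_lt : ∀ i, T < ξ i
  step_le : ∀ i, η * (ξ i)⁻¹ ≤ 1 / stepBound (ξ i) T
  init_pos : ∀ i, 0 < τ₀ i

namespace Admissible

lemma bddAbove (h : Admissible β T η ξ τ₀) :
    BddAbove (Set.range fun p : Fin d × ℕ => |relErr β T η (ξ p.1) (τ₀ p.1) (p.2 + 1)| /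
      |relErr β T η (ξ p.1) (τ₀ p.1) p.2|) := by
  obtain ⟨b, hb⟩ := (Set.finite_range fun i => rateBound β T η (ξ i) (τ₀ i)).bddAbove
  refine ⟨b, ?_⟩
  rintro _ ⟨p, rfl⟩
  exact (abs_relErr_succ_div_le h.beta_pos h.T_pos (h.T_lt _) h.eta_pos (h.step_le _)
    (h.init_pos _) _).trans (hb ⟨p.1, rfl⟩)

lemma ratio_le_worstRate (h : Admissible β T η ξ τ₀) (i : Fin d) (k : ℕ) :
    |relErr β T η (ξ i) (τ₀ i) (k + 1)| / |relErr β T η (ξ i) (τ₀ i) k| ≤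
      worstRate β T η ξ τ₀ :=
  le_ciSup h.bddAbove (i, k)

lemma worstRate_nonneg (β T η : ℝ) (ξ τ₀ : Fin d → ℝ) : 0 ≤ worstRate β T η ξ τ₀ :=
  Real.iSup_nonneg fun _ => by positivity

/-- A supremum over infinitely many times could reach `1`; the time-independent `rateBound` of each
coordinate prevents this, and there are finitely many coordinates. -/
lemma worstRate_lt_one (h : Admissible β T η ξ τ₀) (hd : 0 < d) : worstRate β T η ξ τ₀ < 1 := by
  have : Nonempty (Fin d) := ⟨⟨0, hd⟩⟩
  obtain ⟨j, hj⟩ := Finite.exists_max fun i => rateBound β T η (ξ i) (τ₀ i)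
  refine (ciSup_le fun p => ?_).trans_lt (rateBound_lt_one h.beta_pos h.T_pos (h.T_lt j) h.eta_pos
    (h.step_le j) (h.init_pos j))
  exact (abs_relErr_succ_div_le h.beta_pos h.T_pos (h.T_lt _) h.eta_pos (h.step_le _)
    (h.init_pos _) _).trans (hj p.1)

lemma abs_relErr_succ_le (h : Admissible β T η ξ τ₀) (k : ℕ) (i : Fin d) :
    |relErr β T η (ξ i) (τ₀ i) (k + 1)| ≤
      worstRate β T η ξ τ₀ * |relErr β T η (ξ i) (τ₀ i) k| := by
  rcases eq_or_ne (relErr β T η (ξ i) (τ₀ i) k) 0 with h0 | h0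
  · rw [relErr_succ_eq_zero h.beta_pos h.T_pos (h.T_lt i) h.eta_pos (h.step_le i)
      (h.init_pos i) h0, h0]
    simp
  · rw [← div_le_iff₀ (abs_pos.2 h0)]
    exact h.ratio_le_worstRate i k

lemma abs_relErr_le (h : Admissible β T η ξ τ₀) (k : ℕ) (i : Fin d) :
    |relErr β T η (ξ i) (τ₀ i) k| ≤
      worstRate β T η ξ τ₀ ^ k * |relErr β T η (ξ i) (τ₀ i) 0| := by
  induction k with
  | zero => simp
  | succ k ih =>
    refine (h.abs_relErr_succ_le k i).trans ?_
    rw [pow_succ', mul_assoc]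
    exact mul_le_mul_of_nonneg_left ih (worstRate_nonneg ..)

lemma worstRate_eq_zero_iff (h : Admissible β T η ξ τ₀) :
    worstRate β T η ξ τ₀ = 0 ↔ ∀ i, relErr β T η (ξ i) (τ₀ i) 1 = 0 := by
  constructor
  · intro h0 i
    have := h.abs_relErr_succ_le 0 i
    rw [h0, zero_mul] at this
    exact abs_nonpos_iff.1 this
  · intro h1
    have h2 : ∀ p : Fin d × ℕ, |relErr β T η (ξ p.1) (τ₀ p.1) (p.2 + 1)| /
        |relErr β T η (ξ p.1) (τ₀ p.1) p.2| = 0 := fun p => by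
      rw [relErr_eq_zero_of_le h.beta_pos h.T_pos (h.T_lt _) h.eta_pos (h.step_le _)
        (h.init_pos _) (Nat.le_add_left 1 p.2) (h1 p.1)]
      simp
    unfold worstRate
    simp_rw [h2]
    exact Real.iSup_const_zero

lemma tendsto_relErr (h : Admissible β T η ξ τ₀) (hd : 0 < d) (i : Fin d) :
    Tendsto (relErr β T η (ξ i) (τ₀ i)) atTop (𝓝 0) := by
  refine squeeze_zero_norm (fun k => h.abs_relErr_le k i) ?_
  simpa using (tendsto_pow_atTop_nhds_zero_of_lt_one (worstRate_nonneg β T η ξ τ₀)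
    (h.worstRate_lt_one hd)).mul_const |relErr β T η (ξ i) (τ₀ i) 0|

lemma sqrt_sum_relErr_sq_le (h : Admissible β T η ξ τ₀) (hd : 0 < d) (k : ℕ) :
    √(∑ i, relErr β T η (ξ i) (τ₀ i) k ^ 2) ≤
      rmsInit β T η ξ τ₀ * √d * worstRate β T η ξ τ₀ ^ k := by
  have hc := worstRate_nonneg β T η ξ τ₀
  have hd' : (0 : ℝ) < d := by exact_mod_cast hd
  rw [rmsInit, ← Real.sqrt_mul (by positivity), div_mul_cancel₀ _ hd'.ne']
  refine Real.sqrt_le_iff.2 ⟨by positivity, ?_⟩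
  rw [mul_pow, Real.sq_sqrt (by positivity), Finset.sum_mul]
  refine Finset.sum_le_sum fun i _ => ?_
  rw [← sq_abs, ← sq_abs (relErr β T η (ξ i) (τ₀ i) 0), ← mul_pow, mul_comm]
  exact pow_le_pow_left₀ (abs_nonneg _) (h.abs_relErr_le k i) 2

lemma variance_pos (h : Admissible β T η ξ τ₀) (k : ℕ) (i : Fin d) :
    0 < variance β T η (ξ i) (τ₀ i) k :=
  BRWP.variance_pos h.beta_pos h.T_pos (h.T_lt i) h.eta_pos (h.step_le i) (h.init_pos i) k

lemma xi_pos (h : Admissible β T η ξ τ₀) (i : Fin d) : 0 < ξ i := h.T_pos.trans (h.T_lt i)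

lemma stepLaw_variance (h : Admissible β T η ξ τ₀) (k : ℕ) :
    stepLaw (quadraticPotential (Matrix.diagonal ξ)) β T η
      (diagGaussian fun i => variance β T η (ξ i) (τ₀ i) k) =
      diagGaussian fun i => variance β T η (ξ i) (τ₀ i) (k + 1) :=
  stepLaw_diagGaussian h.xi_pos h.beta_pos h.T_pos (h.variance_pos k)

lemma iterate_stepLaw (h : Admissible β T η ξ τ₀) (k : ℕ) :
    (stepLaw (quadraticPotential (Matrix.diagonal ξ)) β T η)^[k] (diagGaussian τ₀) =
      diagGaussian fun i => variance β T η (ξ i) (τ₀ i) k := by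
  induction k with
  | zero => rfl
  | succ k ih => rw [Function.iterate_succ_apply', ih, h.stepLaw_variance]

lemma hasLaw (h : Admissible β T η ξ τ₀) {Ω : Type*} [MeasurableSpace Ω] {P : Measure Ω}
    {X : ℕ → Ω → E d} (h0 : HasLaw (X 0) (diagGaussian τ₀) P)
    (hX : IsScheme (quadraticPotential (Matrix.diagonal ξ)) β T η P X) (k : ℕ) :
    HasLaw (X k) (diagGaussian fun i => variance β T η (ξ i) (τ₀ i) k) P := by
  induction k with
  | zero => exact h0
  | succ k ih =>
    have hk : X (k + 1) =ᵐ[P] stepMap (quadraticPotential (Matrix.diagonal ξ)) β T η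
        (diagGaussian fun i => variance β T η (ξ i) (τ₀ i) k) ∘ X k := by
      have := hX k
      rwa [ih.map_eq] at this
    -- Measurability is read off from the explicit linear form of the map, available because the
    -- current law is known by induction.
    have hm : Measurable (stepMap (quadraticPotential (Matrix.diagonal ξ)) β T η
        (diagGaussian fun i => variance β T η (ξ i) (τ₀ i) k)) := by
      rw [stepMap_diagGaussian h.xi_pos h.beta_pos h.T_pos (h.variance_pos k)]
      fun_prop
    refine ⟨(hm.comp_aemeasurable ih.aemeasurable).congr hk.symm, ?_⟩
    rw [Measure.map_congr hk, ← AEMeasurable.map_map_of_aemeasurable hm.aemeasurable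
      ih.aemeasurable, ih.map_eq, ← h.stepLaw_variance, stepLaw]

lemma varLimit_pos (h : Admissible β T η ξ τ₀) (i : Fin d) : 0 < varLimit β T (ξ i) :=
  BRWP.varLimit_pos h.beta_pos h.T_pos (h.T_lt i)

lemma tv_le (h : Admissible β T η ξ τ₀) (k : ℕ) :
    tv (diagGaussian fun i => variance β T η (ξ i) (τ₀ i) k)
      (diagGaussian fun i => varLimit β T (ξ i)) ≤
      3 / 2 * min 1 (√(∑ i, relErr β T η (ξ i) (τ₀ i) k ^ 2)) := by
  have h1 := le_min (tv_le_one (diagGaussian fun i => variance β T η (ξ i) (τ₀ i) k)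
    (diagGaussian fun i => varLimit β T (ξ i)))
    (tv_diagGaussian_le (h.variance_pos k) h.varLimit_pos)
  have h2 : 0 ≤ min 1 (√(∑ i, relErr β T η (ξ i) (τ₀ i) k ^ 2)) :=
    le_min zero_le_one (Real.sqrt_nonneg _)
  refine h1.trans ?_
  change min 1 (√(∑ i, relErr β T η (ξ i) (τ₀ i) k ^ 2)) ≤ _
  linarith

lemma bound_le (h : Admissible β T η ξ τ₀) (hd : 0 < d) (k : ℕ) :
    3 / 2 * min 1 (√(∑ i, relErr β T η (ξ i) (τ₀ i) k ^ 2)) ≤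
      3 / 2 * rmsInit β T η ξ τ₀ * √d * worstRate β T η ξ τ₀ ^ k := by
  have := (min_le_right 1 _).trans (h.sqrt_sum_relErr_sq_le hd k)
  linarith

lemma mixingTime_le (h : Admissible β T η ξ τ₀) (hd : 0 < d) {δ : ℝ} {k : ℕ}
    (hk : 3 / 2 * rmsInit β T η ξ τ₀ * √d * worstRate β T η ξ τ₀ ^ k ≤ δ) :
    mixingTime (stepLaw (quadraticPotential (Matrix.diagonal ξ)) β T η) (diagGaussian τ₀)
      (diagGaussian fun i => varLimit β T (ξ i)) δ ≤ k := by
  refine mixingTime_le_of_tv_le ?_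
  rw [h.iterate_stepLaw]
  exact (h.tv_le k).trans ((h.bound_le hd k).trans hk)

end Admissible

/-- A fixed covariance forces each squared factor to be `1`; the factor is positive, hence equal to
`1`, which happens only at zero relative error. -/
lemma stepLaw_diagGaussian_eq_self_iff (hβ : 0 < β) (hT : 0 < T) (hη : 0 < η) (hTξ : ∀ i, T < ξ i)
    (hstep : ∀ i, η * (ξ i)⁻¹ ≤ 1 / stepBound (ξ i) T) {v : Fin d → ℝ} (hv : ∀ i, 0 < v i) :
    stepLaw (quadraticPotential (Matrix.diagonal ξ)) β T η (diagGaussian v) = diagGaussian v ↔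
      v = fun i => varLimit β T (ξ i) := by
  rw [stepLaw_diagGaussian (fun i => hT.trans (hTξ i)) hβ hT hv]
  constructor
  · intro h
    have h1 := diagGaussian_injective (fun i => mul_nonneg (sq_nonneg _) (hv i).le)
      (fun i => (hv i).le) h
    funext i
    have h2 : stepFactor β T η (ξ i) (v i) ^ 2 = 1 := by
      have := congrFun h1 i
      exact (mul_eq_right₀ (hv i).ne').1 this
    have h3 := stepFactor_pos hβ hT (hTξ i) hη (hstep i) (hv i)
    exact (stepFactor_eq_one_iff hβ hT (hTξ i) hη (hv i)).1
      ((pow_eq_one_iff_of_nonneg h3.le two_ne_zero).1 h2)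
  · intro h
    congr 1
    funext i
    rw [(stepFactor_eq_one_iff hβ hT (hTξ i) hη (hv i)).2 (congrFun h i)]
    ring

lemma roots_charpoly_diagonal_mul_inv_sub_one {v u : Fin d → ℝ} (hu : ∀ i, u i ≠ 0) :
    (Matrix.diagonal v * (Matrix.diagonal u)⁻¹ - 1).charpoly.roots =
      (Finset.univ : Finset (Fin d)).val.map fun i => (v i - u i) / u i := by
  have h : Matrix.diagonal v * (Matrix.diagonal u)⁻¹ - 1 =
      Matrix.diagonal fun i => (v i - u i) / u i := by
    rw [inv_diagonal_of_ne_zero hu, Matrix.diagonal_mul_diagonal, ← Matrix.diagonal_one,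
      Matrix.diagonal_sub]
    congr 1
    funext i
    rw [sub_div, div_self (hu i), div_eq_mul_inv]
  rw [h, Matrix.charpoly_diagonal]
  exact Polynomial.roots_multiset_prod_X_sub_C
    ((Finset.univ : Finset (Fin d)).val.map fun i => (v i - u i) / u i) ▸ by
      simp [Finset.prod, Function.comp_def]

end Chain

end BRWP

theorem mainTheorem1 {d : ℕ} (hd : 0 < d) (ξ : Fin d → ℝ) (β T η : ℝ)
    (hξ : ∀ i, 0 < ξ i) (hβ : 0 < β) (hT : 0 < T) (hη : 0 < η)
    (hTξ : ∀ i, T < ξ i) (hstep : ∀ i, η * (ξ i)⁻¹ ≤ 1 / BRWP.stepBound (ξ i) T)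
    (V : BRWP.E d → ℝ) (hV : V = BRWP.quadraticPotential (Matrix.diagonal ξ))
    (τinf : Fin d → ℝ) (hτinf : τinf = fun i => BRWP.varLimit β T (ξ i)) :
    -- the stationary distribution
    (∀ i, 0 < τinf i) ∧
    BRWP.stepLaw V β T η (BRWP.diagGaussian τinf) = BRWP.diagGaussian τinf ∧
    (∀ v : Fin d → ℝ, (∀ i, 0 < v i) →
      BRWP.stepLaw V β T η (BRWP.diagGaussian v) = BRWP.diagGaussian v → v = τinf) ∧
    -- the chain, for every initial covariance
    ∀ (τ₀ : Fin d → ℝ) (_ : ∀ i, 0 < τ₀ i)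
      (τ lam : ℕ → Fin d → ℝ) (C c : ℝ)
      (_ : τ = fun k i => BRWP.variance β T η (ξ i) (τ₀ i) k)
      (_ : lam = fun k i => BRWP.relErr β T η (ξ i) (τ₀ i) k)
      (_ : C = BRWP.rmsInit β T η ξ τ₀) (_ : c = BRWP.worstRate β T η ξ τ₀)
      {Ω : Type*} [MeasurableSpace Ω] (P : Measure Ω) [IsProbabilityMeasure P]
      (X : ℕ → Ω → BRWP.E d) (_ : HasLaw (X 0) (BRWP.diagGaussian τ₀) P)
      (_ : BRWP.IsScheme V β T η P X),
      -- the distribution of the iterates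
      (∀ k i, 0 < τ k i) ∧
      (∀ k, HasLaw (X k) (BRWP.diagGaussian (τ k)) P) ∧
      -- the eigenvalues, with multiplicity, of `Σ_k Σ_∞⁻¹ - I`
      (∀ k, (Matrix.diagonal (τ k) * (Matrix.diagonal τinf)⁻¹ - 1).charpoly.roots =
        (Finset.univ : Finset (Fin d)).val.map (lam k)) ∧
      -- they converge linearly to zero, with the asymptotic rate
      (∀ i, Tendsto (fun k => lam k i) atTop (𝓝 0) ∧
        ((∀ᶠ k in atTop, lam k i = 0) ∨
          Tendsto (fun k => lam (k + 1) i / lam k i) atTop (𝓝 (BRWP.asympRate T η (ξ i)))) ∧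
        0 ≤ BRWP.asympRate T η (ξ i) ∧ BRWP.asympRate T η (ξ i) < 1 ∧
        (BRWP.asympRate T η (ξ i) = 0 ↔
          ξ i = 7 * T ∧ η * (ξ i)⁻¹ = 1 / BRWP.stepBound (ξ i) T)) ∧
      -- the uniform contraction factor
      0 ≤ c ∧ c < 1 ∧ (c = 0 ↔ ∀ i, lam 1 i = 0) ∧
      (∀ k i, |lam (k + 1) i| ≤ c * |lam k i|) ∧
      -- the total variation bound
      (∀ k, BRWP.tv (P.map (X k)) (BRWP.diagGaussian τinf) ≤
          3 / 2 * min 1 (√(∑ i, lam k i ^ 2)) ∧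
        3 / 2 * min 1 (√(∑ i, lam k i ^ 2)) ≤ 3 / 2 * C * √d * c ^ k) ∧
      -- the mixing time
      (∀ δ : ℝ, 0 < δ → δ < 1 →
        (c = 0 → BRWP.mixingTime (BRWP.stepLaw V β T η) (P.map (X 0))
          (BRWP.diagGaussian τinf) δ ≤ 1) ∧
        (0 < c → BRWP.mixingTime (BRWP.stepLaw V β T η) (P.map (X 0))
          (BRWP.diagGaussian τinf) δ ≤
            (⌈Real.log (3 / 2 * C * √d / δ) / Real.log (1 / c)⌉₊ : ℕ∞)) ∧
        (0 < c → δ ≤ 2 / 3 * c * C * √d →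
          ∃ n : ℕ, BRWP.mixingTime (BRWP.stepLaw V β T η) (P.map (X 0))
            (BRWP.diagGaussian τinf) δ = n ∧
            (n : ℝ) ≤ 2 * (Real.log (C * √d / δ) / Real.log (1 / c)))) := by
  subst hV hτinf
  have hadm : ∀ τ₀ : Fin d → ℝ, (∀ i, 0 < τ₀ i) → BRWP.Admissible β T η ξ τ₀ :=
    fun τ₀ h0 => ⟨hβ, hT, hη, hTξ, hstep, h0⟩
  have hpos : ∀ i, 0 < BRWP.varLimit β T (ξ i) := fun i => BRWP.varLimit_pos hβ hT (hTξ i)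
  refine ⟨hpos, (BRWP.stepLaw_diagGaussian_eq_self_iff hβ hT hη hTξ hstep hpos).2 rfl,
    fun v hv => (BRWP.stepLaw_diagGaussian_eq_self_iff hβ hT hη hTξ hstep hv).1, ?_⟩
  intro τ₀ hτ₀ τ lam C c hτ hlam hC hc Ω _ P _ X hX0 hX
  have h := hadm τ₀ hτ₀
  have hlaw := fun k => h.hasLaw hX0 hX k
  subst hτ hlam hC hc
  refine ⟨h.variance_pos, hlaw, fun k =>
    BRWP.roots_charpoly_diagonal_mul_inv_sub_one fun i => (hpos i).ne', fun i =>
    ⟨h.tendsto_relErr hd i, BRWP.tendsto_relErr_ratio hβ hT (hTξ i) hη (hstep i) (hτ₀ i)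
      (h.tendsto_relErr hd i), BRWP.asympRate_nonneg hT (hTξ i) hη (hstep i),
      BRWP.asympRate_lt_one hT (hTξ i) hη, BRWP.asympRate_eq_zero_iff hT (hTξ i) (hstep i)⟩,
    BRWP.Admissible.worstRate_nonneg .., h.worstRate_lt_one hd, h.worstRate_eq_zero_iff,
    h.abs_relErr_succ_le, fun k => ⟨?_, h.bound_le hd k⟩, fun δ hδ _ => ?_⟩
  · rw [(hlaw k).map_eq]
    exact h.tv_le k
  rw [hX0.map_eq]
  have hceil : 0 < BRWP.worstRate β T η ξ τ₀ → BRWP.mixingTime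
      (BRWP.stepLaw (BRWP.quadraticPotential (Matrix.diagonal ξ)) β T η) (BRWP.diagGaussian τ₀)
      (BRWP.diagGaussian fun i => BRWP.varLimit β T (ξ i)) δ ≤
      (⌈Real.log (3 / 2 * BRWP.rmsInit β T η ξ τ₀ * √d / δ) /
        Real.log (1 / BRWP.worstRate β T η ξ τ₀)⌉₊ : ℕ∞) := fun hc =>
    h.mixingTime_le hd (BRWP.mul_pow_ceil_log_le
      (mul_nonneg (mul_nonneg (by norm_num) (Real.sqrt_nonneg _)) (Real.sqrt_nonneg _)) hc
      (h.worstRate_lt_one hd) hδ)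
  refine ⟨fun hc => ?_, hceil, fun hc hδC => ?_⟩
  -- One step is taken because `c ^ 0 = 1` even for `c = 0`, whereas `c ^ 1 = 0`.
  · exact_mod_cast h.mixingTime_le hd (k := 1) (by rw [hc, pow_one, mul_zero]; exact hδ.le)
  · obtain ⟨n, hn, hle⟩ := BRWP.exists_mixingTime_eq (hceil hc)
    refine ⟨n, hn, (Nat.cast_le.2 hle).trans ?_⟩
    have := BRWP.ceil_log_le_two_mul (M := BRWP.rmsInit β T η ξ τ₀ * √d) hc
      (h.worstRate_lt_one hd) hδ (by rw [← mul_assoc]; exact hδC)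
    rwa [← mul_assoc] at this
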